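/- Let $\mathbb K$ be a field and let $E=(E^0,E^1,r,s)$ be a directed graph without isolated vertices (every vertex is the source or the range of some edge). Let $L_{\mathbb K}(E)$ be the Leavitt path algebra of $E$: the (not necessarily unital) $\mathbb K$-algebra generated by pairwise orthogonal idempotents $v\in E^0$ and elements $f,f^*$ ($f\in E^1$) subject to $s(f)f=fr(f)=f$, $r(f)f^*=f^*s(f)=f^*$, $f^*f'=\delta_{f,f'}r(f)$, and $v=\sum_{s(f)=v}ff^*$ whenever $s^{-1}(v)$ is finite and non-empty. Let $W$ be the set of finite paths of nonzero length, let $\mathbb F$ be the free group on $E^1$, and let $X$ be the set consisting of the sinks of $E$, the paths in $W$ whose range is a sink, and the infinite paths. For $g\in\mathbb F$ define $X_g\subseteq X$ by: $X_e=X$; $X_{b^{-1}}=\{\xi\in X: s(\xi)=r(b)\}$ for $b\in W$; $X_a=\{\xi\in X:\xi \text{ begins with } a\}$ for $a\in W$; $X_{ab^{-1}}=X_a$ for $a,b\in W$ with $r(a)=r(b)$ and $ab^{-1}$ reduced; and $X_g=\emptyset$ for all other $g$. Let $1_g:X\to\mathbb K$ be the characteristic function of $X_g$. For an infinite emitter $v$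 (a vertex with $s^{-1}(v)$ infinite) consider the formal series $\sum_{s(f)=v}1_f$; at each point of $X$ at most one of its terms is nonzero, and it is identified with the function on $X$ that is its pointwise sum. Let $$D^s(X)=\operatorname{span}_{\mathbb K}\Big(\{1_g: g\in\mathbb F\setminus\{e\}\}\cup\Big\{\sum_{s(f)=v}1_f : v\text{ an infinite emitter}\Big\}\Big),$$ which is an algebra under pointwise multiplication. For $f\in E^1$ let $\theta_f:X_{f^{-1}}\to X_f$ be the bijection that puts $f$ in front of $\xi$ (with $\theta_f(r(f))=f$ if $r(f)$ is a sink), and let $\beta_f:1_{f^{-1}}D^s(X)\to 1_fD^s(X)$ be the algebra isomorphism $\varphi\mapsto\varphi\circ\theta_f^{-1}$ (extended by zero outside $X_f$); it satisfies $\beta_f(1_{f^{-1}}1_h)=1_f1_{fh}$ for all $h\in\mathbb F$. Let $\beta=(D^s_g,\beta_g)_{g\in\mathbb F}$ be the semi-saturated partial action of $\mathbb F$ on $D^s(X)$ generated by the partial symmetries $\beta_f$: for $g$ with reduced word $x_1\cdots x_n$, $\beta_g=\beta_{x_1}\circ\cdots\circ\beta_{x_n}$ as a composition of partial bijections, where $\beta_{f^{-1}}=\beta_f^{-1}$,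 and $D^s_g$ is the range of $\beta_g$. Let $D^s(X)\star_\beta\mathbb F=\bigoplus_{g\in\mathbb F}D^s_g\delta_g$ be the partial skew group ring, with product $(x\delta_g)(y\delta_h)=\beta_g(\beta_{g^{-1}}(x)\,y)\,\delta_{gh}$. Then $L_{\mathbb K}(E)$ and $D^s(X)\star_\beta\mathbb F$ are isomorphic as $\mathbb K$-algebras. -/

import Mathlib

universe u v w

/-! ## Partial actions on algebras and partial skew group rings -/

/-- A partial action of the group `G` on the (not necessarily unital) `K`-algebra `R`: ideals `D g`
and algebra isomorphisms `act g : D g⁻¹ → D g` satisfying the three axioms of a partial action. -/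
structure AlgPartialAction (G : Type u) (K : Type v) (R : Type w) [Group G] [CommRing K]
    [NonUnitalRing R] [Module K R] where
  /-- the ideal `D g` -/
  D : G → Submodule K R
  mul_mem_left : ∀ (g : G) (r x : R), x ∈ D g → r * x ∈ D g
  mul_mem_right : ∀ (g : G) (r x : R), x ∈ D g → x * r ∈ D g
  /-- the isomorphism from `D g⁻¹` onto `D g` -/
  act : ∀ g : G, D g⁻¹ ≃ₗ[K] D g
  act_mul : ∀ (g : G) (x y : D g⁻¹),
    (act g ⟨(x : R) * (y : R), mul_mem_left _ _ _ y.2⟩ : R) = (act g x : R) * (act g y : R)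
  D_one : D 1 = ⊤
  act_one : ∀ x : D (1 : G)⁻¹, (act 1 x : R) = (x : R)
  image_inter : ∀ g h : G,
    {y : R | ∃ x : D g⁻¹, (x : R) ∈ D h ∧ (act g x : R) = y} = (D g : Set R) ∩ (D (g * h) : Set R)
  act_act : ∀ (g h : G) (r : R) (h₁ : r ∈ D h⁻¹) (h₂ : r ∈ D (g * h)⁻¹)
    (h₃ : (act h ⟨r, h₁⟩ : R) ∈ D g⁻¹), (act g ⟨_, h₃⟩ : R) = (act (g * h) ⟨r, h₂⟩ : R)

namespace AlgPartialAction

section Skew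

variable {G : Type u} {K : Type v} {R : Type w} [Group G] [CommRing K]
  [NonUnitalRing R] [Module K R] (P : AlgPartialAction G K R)

/-- `act g⁻¹` and `(act g)⁻¹` agree on `D g`. -/
theorem act_inv (g : G) (x : R) (hx : x ∈ P.D g) (hx' : x ∈ P.D g⁻¹⁻¹) :
    (P.act g⁻¹ ⟨x, hx'⟩ : R) = ((P.act g).symm ⟨x, hx⟩ : R) := by
  set y := (P.act g).symm ⟨x, hx⟩ with hy
  have hxy : (P.act g y : R) = x := by simp [hy]
  have key := P.act_act g⁻¹ g (y : R) y.2 (by rw [inv_mul_cancel, inv_one, P.D_one]; trivial)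
    (by simpa [hxy] using hx')
  have h1 : ∀ (k : G) (hk : k = 1) (z : R) (hz : z ∈ P.D k⁻¹), (P.act k ⟨z, hz⟩ : R) = z := by
    intro k hk z hz
    subst hk
    exact P.act_one _
  rw [h1 _ (inv_mul_cancel g)] at key
  rw [← key]
  congr 2
  exact Subtype.ext hxy.symm

theorem mul_aux (g h : G) (r : P.D g) (r' : P.D h) :
    ((P.act g ⟨((P.act g).symm r : R) * (r' : R),
      P.mul_mem_right _ _ _ ((P.act g).symm r).2⟩ : P.D g) : R) ∈ P.D (g * h) := by
  have : ((P.act g ⟨((P.act g).symm r : R) * (r' : R),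
      P.mul_mem_right _ _ _ ((P.act g).symm r).2⟩ : P.D g) : R) ∈
      (P.D g : Set R) ∩ (P.D (g * h) : Set R) := by
    rw [← P.image_inter]
    exact ⟨_, P.mul_mem_left _ _ _ r'.2, rfl⟩
  exact this.2

/-- The partial skew group ring: the direct sum of the `D g δ_g`, where `r δ_g` is the element `r`
in the summand of index `g`. -/
def SkewGroupRing : Type (max u w) := DirectSum G (fun g => P.D g)

noncomputable instance : AddCommGroup P.SkewGroupRing :=
  inferInstanceAs (AddCommGroup (DirectSum G (fun g => P.D g)))

noncomputable instance : Module K P.SkewGroupRing :=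
  inferInstanceAs (Module K (DirectSum G (fun g => P.D g)))

open Classical in
/-- The element `r δ_g`. -/
noncomputable def delta (g : G) : P.D g →ₗ[K] P.SkewGroupRing :=
  DirectSum.lof K G (fun g => P.D g) g

open Classical in
/-- The linear map out of the direct sum with given restrictions to the summands. -/
noncomputable def lift {N : Type*} [AddCommGroup N] [Module K N] (F : ∀ g, P.D g →ₗ[K] N) :
    P.SkewGroupRing →ₗ[K] N :=
  DirectSum.toModule K G N F

theorem lift_delta {N : Type*} [AddCommGroup N] [Module K N] (F : ∀ g, P.D g →ₗ[K] N)
    (g : G) (r : P.D g) : P.lift F (P.delta g r) = F g r := by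
  classical
  exact DirectSum.toModule_lof K g r (M := fun g => P.D g) (φ := F)

variable [SMulCommClass K R R] [IsScalarTower K R R]

/-- The product `(r δ_g) (r' δ_h) = act g (act g⁻¹ r * r') δ_{gh}` of homogeneous elements, as a
bilinear map with values in the coefficient of `δ_{gh}`; recall `act g⁻¹ = (act g)⁻¹`. -/
def mulHomogeneous (g h : G) : P.D g →ₗ[K] P.D h →ₗ[K] P.D (g * h) :=
  LinearMap.mk₂ K
    (fun r r' => ⟨(P.act g ⟨((P.act g).symm r : R) * (r' : R),
      P.mul_mem_right _ _ _ ((P.act g).symm r).2⟩ : P.D g), P.mul_aux g h r r'⟩)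
    (fun a b c => Subtype.ext <| Eq.trans
      (congrArg (fun z : P.D g⁻¹ => (P.act g z : R)) (Subtype.ext (by simp [add_mul])))
      (congrArg Subtype.val (map_add (P.act g) ⟨((P.act g).symm a : R) * (c : R),
        P.mul_mem_right _ _ _ ((P.act g).symm a).2⟩ ⟨((P.act g).symm b : R) * (c : R),
        P.mul_mem_right _ _ _ ((P.act g).symm b).2⟩)))
    (fun k a c => Subtype.ext <| Eq.trans
      (congrArg (fun z : P.D g⁻¹ => (P.act g z : R)) (Subtype.ext (by simp [smul_mul_assoc])))
      (congrArg Subtype.val (map_smul (P.act g) k ⟨((P.act g).symm a : R) * (c : R),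
        P.mul_mem_right _ _ _ ((P.act g).symm a).2⟩)))
    (fun a b c => Subtype.ext <| Eq.trans
      (congrArg (fun z : P.D g⁻¹ => (P.act g z : R)) (Subtype.ext (by simp [mul_add])))
      (congrArg Subtype.val (map_add (P.act g) ⟨((P.act g).symm a : R) * (b : R),
        P.mul_mem_right _ _ _ ((P.act g).symm a).2⟩ ⟨((P.act g).symm a : R) * (c : R),
        P.mul_mem_right _ _ _ ((P.act g).symm a).2⟩)))
    (fun k a c => Subtype.ext <| Eq.trans
      (congrArg (fun z : P.D g⁻¹ => (P.act g z : R)) (Subtype.ext (by simp [mul_smul_comm])))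
      (congrArg Subtype.val (map_smul (P.act g) k ⟨((P.act g).symm a : R) * (c : R),
        P.mul_mem_right _ _ _ ((P.act g).symm a).2⟩)))

/-- The multiplication of the partial skew group ring: the bilinear extension of
`mulHomogeneous`. -/
noncomputable def skewMul : P.SkewGroupRing →ₗ[K] P.SkewGroupRing →ₗ[K] P.SkewGroupRing :=
  P.lift fun g => LinearMap.flip (P.lift fun h =>
      LinearMap.flip ((P.mulHomogeneous g h).compr₂ (P.delta (g * h))))

noncomputable instance : NonUnitalNonAssocRing P.SkewGroupRing where
  mul x y := P.skewMul x y
  left_distrib x y z := map_add (P.skewMul x) y z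
  right_distrib x y z := LinearMap.map_add₂ P.skewMul x y z
  zero_mul x := LinearMap.map_zero₂ P.skewMul x
  mul_zero x := map_zero (P.skewMul x)

theorem delta_mul_delta (g h : G) (r : P.D g) (r' : P.D h) :
    P.delta g r * P.delta h r' = P.delta (g * h) (P.mulHomogeneous g h r r') := by
  change P.skewMul _ _ = _
  rw [skewMul, lift_delta, LinearMap.flip_apply, lift_delta]
  rfl

end Skew

/-! ### Partial actions from partial symmetries -/

section OfPEquiv

variable {K : Type v} {R : Type w} [CommRing K] [NonUnitalRing R] [Module K R]

/-- A partial symmetry whose domain is an ideal and which respects the algebra operations. -/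
structure IsPartialAlgHom (K : Type v) {R : Type w} [CommRing K] [NonUnitalRing R] [Module K R]
    (φ : R ≃. R) : Prop where
  zero : (0 : R) ∈ φ 0
  add : ∀ x y x' y', x' ∈ φ x → y' ∈ φ y → x' + y' ∈ φ (x + y)
  smul : ∀ (k : K) x x', x' ∈ φ x → k • x' ∈ φ (k • x)
  mul : ∀ x y x' y', x' ∈ φ x → y' ∈ φ y → x' * y' ∈ φ (x * y)
  ideal_left : ∀ r x x', x' ∈ φ x → ∃ z, z ∈ φ (r * x)
  ideal_right : ∀ r x x', x' ∈ φ x → ∃ z, z ∈ φ (x * r)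

/-- The range of a partial symmetry, as a submodule. -/
def rangeSubmodule (φ : R ≃. R) (h : IsPartialAlgHom K φ) : Submodule K R where
  carrier := {y | ∃ x, y ∈ φ x}
  zero_mem' := ⟨0, h.zero⟩
  add_mem' := fun ⟨x, hx⟩ ⟨y, hy⟩ => ⟨x + y, h.add _ _ _ _ hx hy⟩
  smul_mem' := fun k _ ⟨x, hx⟩ => ⟨k • x, h.smul _ _ _ hx⟩

theorem mem_rangeSubmodule (φ : R ≃. R) (h : IsPartialAlgHom K φ) (y : R) :
    y ∈ rangeSubmodule φ h ↔ ∃ x, y ∈ φ x := Iff.rfl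

variable {G : Type u} [Group G]

/-- A family `β` of partial symmetries with `β 1 = id`, `β g⁻¹ = (β g)⁻¹` and
`β g ∘ β h ⊆ β (g h)`, each of which is an algebra isomorphism between ideals, is a partial action;
its ideal `D g` is the range of `β g`. -/
def ofPEquiv (β : G → R ≃. R) (h1 : β 1 = PEquiv.refl R) (hinv : ∀ g, β g⁻¹ = (β g).symm)
    (hmul : ∀ g h, (β h).trans (β g) ≤ β (g * h)) (hβ : ∀ g, IsPartialAlgHom K (β g)) :
    AlgPartialAction G K R :=
  have hdom : ∀ (g : G) (x : rangeSubmodule (β g⁻¹) (hβ g⁻¹)), (β g x).isSome := fun g x => by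
    obtain ⟨x, y, hy⟩ := x
    rw [hinv, PEquiv.mem_iff_mem] at hy
    exact Option.isSome_iff_exists.2 ⟨y, hy⟩
  have hran : ∀ (g : G) (x : rangeSubmodule (β g) (hβ g)), (β g⁻¹ x).isSome := fun g x => by
    obtain ⟨x, y, hy⟩ := x
    rw [← PEquiv.mem_iff_mem, ← hinv] at hy
    exact Option.isSome_iff_exists.2 ⟨y, hy⟩
  have hget : ∀ (g : G) (x) (h : (β g x).isSome), (β g x).get h ∈ β g x := fun g x h =>
    Option.get_mem h
  have hget_eq : ∀ (g : G) (x y) (h : (β g x).isSome), y ∈ β g x → (β g x).get h = y :=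
    fun g x y h hy => Option.get_of_mem h hy
  have hmem : ∀ (g : G) (x y : R), x ∈ β g⁻¹ y ↔ y ∈ β g x := fun g x y => by
    rw [hinv, PEquiv.mem_iff_mem]
  { D := fun g => rangeSubmodule (β g) (hβ g)
    mul_mem_left := fun g r x ⟨y, hy⟩ => by
      obtain ⟨z, hz⟩ := (hβ g⁻¹).ideal_left r x y ((hmem g y x).2 hy)
      exact ⟨z, (hmem g z _).1 hz⟩
    mul_mem_right := fun g r x ⟨y, hy⟩ => by
      obtain ⟨z, hz⟩ := (hβ g⁻¹).ideal_right r x y ((hmem g y x).2 hy)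
      exact ⟨z, (hmem g z _).1 hz⟩
    act := fun g =>
      { toFun := fun x => ⟨(β g x).get (hdom g x), x, hget _ _ _⟩
        invFun := fun y => ⟨(β g⁻¹ y).get (hran g y), y, hget _ _ _⟩
        map_add' := fun x y => Subtype.ext <| hget_eq _ _ _ _ <|
          (hβ g).add _ _ _ _ (hget _ _ _) (hget _ _ _)
        map_smul' := fun k x => Subtype.ext <| hget_eq _ _ _ _ <| (hβ g).smul _ _ _ (hget _ _ _)
        left_inv := fun x => Subtype.ext <| hget_eq _ _ _ _ <| (hmem g _ _).2 (hget _ _ _)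
        right_inv := fun x => Subtype.ext <| hget_eq _ _ _ _ <| (hmem g _ _).1 (hget _ _ _) }
    act_mul := fun g x y => hget_eq _ _ _ _ <| (hβ g).mul _ _ _ _ (hget _ _ _) (hget _ _ _)
    D_one := by
      refine eq_top_iff.2 fun x _ => ⟨x, ?_⟩
      rw [h1]; rfl
    act_one := fun x => hget_eq _ _ _ _ <| by rw [h1]; rfl
    image_inter := fun g h => by
      ext y
      constructor
      · rintro ⟨x, ⟨z, hz⟩, rfl⟩
        exact ⟨⟨x, hget _ _ _⟩, z, hmul g h _ _
          ((PEquiv.mem_trans _ _ _ _).2 ⟨_, hz, hget _ _ _⟩)⟩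
      · rintro ⟨⟨x, hx⟩, z, hz⟩
        have hx' := (hmem g x y).2 hx
        refine ⟨⟨x, y, hx'⟩, ⟨z, ?_⟩, hget_eq _ _ _ _ hx⟩
        have := hmul g⁻¹ (g * h) z x ((PEquiv.mem_trans _ _ _ _).2 ⟨_, hz, hx'⟩)
        rwa [inv_mul_cancel_left] at this
    act_act := fun g h r h₁ h₂ h₃ => Eq.symm <| hget_eq _ _ _ _ <| hmul g h _ _ <|
      (PEquiv.mem_trans _ _ _ _).2 ⟨_, hget _ _ (hdom h ⟨r, h₁⟩), hget _ _ (hdom g ⟨_, h₃⟩)⟩ }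

end OfPEquiv

/-! ### The semi-saturated partial action of a free group generated by partial symmetries -/

section FreeGroup

variable {A : Type u} {R : Type w}

/-- The partial symmetry attached to a letter `f` or `f⁻¹`. -/
def letterSymm (β : A → R ≃. R) (x : A × Bool) : R ≃. R :=
  if x.2 then β x.1 else (β x.1).symm

/-- The composition of the partial symmetries along a word; the last letter acts first. Partial maps
are composed on the largest domain on which the composition makes sense. -/
def wordSymm (β : A → R ≃. R) : List (A × Bool) → R ≃. R
  | [] => PEquiv.refl R
  | x :: l => (wordSymm β l).trans (letterSymm β x)

open Classical in
/-- The value at `g` of the semi-saturated partial action of the free group generated by the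
partial symmetries `β f`: their composition along the reduced word of `g`. -/
noncomputable def freeSymm (β : A → R ≃. R) (g : FreeGroup A) : R ≃. R := wordSymm β g.toWord

theorem wordSymm_append (β : A → R ≃. R) (l l' : List (A × Bool)) :
    wordSymm β (l ++ l') = (wordSymm β l').trans (wordSymm β l) := by
  induction l with
  | nil => simp [wordSymm]
  | cons x l ih => simp [wordSymm, ih, PEquiv.trans_assoc]

theorem letterSymm_not (β : A → R ≃. R) (a : A) (b : Bool) :
    letterSymm β (a, !b) = (letterSymm β (a, b)).symm := by
  cases b <;> simp [letterSymm]

theorem wordSymm_invRev (β : A → R ≃. R) (l : List (A × Bool)) :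
    wordSymm β (FreeGroup.invRev l) = (wordSymm β l).symm := by
  induction l with
  | nil => rfl
  | cons x l ih =>
    obtain ⟨a, b⟩ := x
    have : FreeGroup.invRev ((a, b) :: l) = FreeGroup.invRev l ++ [(a, !b)] := by
      simp [FreeGroup.invRev]
    rw [this, wordSymm_append, ih]
    simp [wordSymm, letterSymm_not, PEquiv.symm_trans_rev]

theorem symm_trans_le (φ : R ≃. R) : (φ.symm).trans φ ≤ PEquiv.refl R := by
  intro a b h
  obtain ⟨c, h1, h2⟩ := (PEquiv.mem_trans _ _ _ _).1 h
  rw [PEquiv.mem_iff_mem] at h1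
  rw [Option.mem_def] at h1 h2 ⊢
  rw [PEquiv.refl_apply, ← h1, h2]

theorem trans_mono {φ φ' ψ ψ' : R ≃. R} (h : φ ≤ φ') (h' : ψ ≤ ψ') :
    φ.trans ψ ≤ φ'.trans ψ' := by
  intro a b hab
  obtain ⟨c, h1, h2⟩ := (PEquiv.mem_trans _ _ _ _).1 hab
  exact (PEquiv.mem_trans _ _ _ _).2 ⟨c, h _ _ h1, h' _ _ h2⟩

theorem wordSymm_le_of_red (β : A → R ≃. R) {l l' : List (A × Bool)} (h : FreeGroup.Red l l') :
    wordSymm β l ≤ wordSymm β l' := by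
  induction h with
  | refl => exact le_rfl
  | tail _ hs ih =>
    refine ih.trans ?_
    cases hs with
    | @not L₁ L₂ x b =>
      rw [wordSymm_append, wordSymm_append]
      refine trans_mono ?_ le_rfl
      have : wordSymm β ((x, b) :: (x, !b) :: L₂) =
          (wordSymm β L₂).trans (((letterSymm β (x, b)).symm).trans (letterSymm β (x, b))) := by
        simp [wordSymm, letterSymm_not, PEquiv.trans_assoc]
      rw [this]
      calc _ ≤ (wordSymm β L₂).trans (PEquiv.refl R) := trans_mono le_rfl (symm_trans_le _)
        _ = _ := PEquiv.trans_refl _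

theorem freeSymm_one (β : A → R ≃. R) : freeSymm β 1 = PEquiv.refl R := by
  simp [freeSymm, wordSymm]

theorem freeSymm_of (β : A → R ≃. R) (f : A) : freeSymm β (FreeGroup.of f) = β f := by
  simp [freeSymm, wordSymm, letterSymm]

theorem freeSymm_inv (β : A → R ≃. R) (g : FreeGroup A) :
    freeSymm β g⁻¹ = (freeSymm β g).symm := by
  classical
  simp only [freeSymm]
  rw [FreeGroup.toWord_inv, wordSymm_invRev]

theorem freeSymm_mul (β : A → R ≃. R) (g h : FreeGroup A) :
    (freeSymm β h).trans (freeSymm β g) ≤ freeSymm β (g * h) := by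
  classical
  simp only [freeSymm]
  rw [← wordSymm_append, FreeGroup.toWord_mul]
  exact wordSymm_le_of_red β FreeGroup.reduce.red

open Classical in
/-- Semi-saturation: `β (g h) = β g ∘ β h` if there is no cancellation in the product `g h`. -/
theorem freeSymm_mul_of_norm (β : A → R ≃. R) (g h : FreeGroup A)
    (hgh : (g * h).norm = g.norm + h.norm) :
    freeSymm β (g * h) = (freeSymm β h).trans (freeSymm β g) := by
  have key : (g * h).toWord = g.toWord ++ h.toWord := by
    rw [FreeGroup.toWord_mul]
    refine (FreeGroup.reduce.red.sublist).eq_of_length ?_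
    rw [← FreeGroup.toWord_mul, List.length_append]
    exact hgh
  simp only [freeSymm]
  rw [← wordSymm_append, ← key]

variable {K : Type v} [CommRing K] [NonUnitalRing R] [Module K R]

theorem IsPartialAlgHom.refl : IsPartialAlgHom K (PEquiv.refl R) where
  zero := rfl
  add := by rintro x y x' y' ⟨⟩ ⟨⟩; rfl
  smul := by rintro k x x' ⟨⟩; rfl
  mul := by rintro x y x' y' ⟨⟩ ⟨⟩; rfl
  ideal_left r x x' _ := ⟨r * x, rfl⟩
  ideal_right r x x' _ := ⟨x * r, rfl⟩

/-- The composition `ψ ∘ φ`, if the domain of `φ` has local units. -/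
theorem IsPartialAlgHom.trans {φ ψ : R ≃. R} (hφ : IsPartialAlgHom K φ)
    (hψ : IsPartialAlgHom K ψ)
    (hu : ∀ x x', x' ∈ φ x → ∃ e e', e' ∈ φ e ∧ e * x = x ∧ x * e = x) :
    IsPartialAlgHom K (φ.trans ψ) where
  zero := (PEquiv.mem_trans _ _ _ _).2 ⟨0, hφ.zero, hψ.zero⟩
  add x y x' y' hx hy := by
    obtain ⟨a, ha, ha'⟩ := (PEquiv.mem_trans _ _ _ _).1 hx
    obtain ⟨b, hb, hb'⟩ := (PEquiv.mem_trans _ _ _ _).1 hy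
    exact (PEquiv.mem_trans _ _ _ _).2 ⟨_, hφ.add _ _ _ _ ha hb, hψ.add _ _ _ _ ha' hb'⟩
  smul k x x' hx := by
    obtain ⟨a, ha, ha'⟩ := (PEquiv.mem_trans _ _ _ _).1 hx
    exact (PEquiv.mem_trans _ _ _ _).2 ⟨_, hφ.smul _ _ _ ha, hψ.smul _ _ _ ha'⟩
  mul x y x' y' hx hy := by
    obtain ⟨a, ha, ha'⟩ := (PEquiv.mem_trans _ _ _ _).1 hx
    obtain ⟨b, hb, hb'⟩ := (PEquiv.mem_trans _ _ _ _).1 hy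
    exact (PEquiv.mem_trans _ _ _ _).2 ⟨_, hφ.mul _ _ _ _ ha hb, hψ.mul _ _ _ _ ha' hb'⟩
  ideal_left r x x' hx := by
    obtain ⟨a, ha, ha'⟩ := (PEquiv.mem_trans _ _ _ _).1 hx
    obtain ⟨e, e', he, hex, -⟩ := hu x a ha
    obtain ⟨c, hc⟩ := hφ.ideal_left r e e' he
    obtain ⟨d, hd⟩ := hψ.ideal_left c a x' ha'
    refine ⟨d, (PEquiv.mem_trans _ _ _ _).2 ⟨c * a, ?_, hd⟩⟩
    have := hφ.mul _ _ _ _ hc ha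
    rwa [mul_assoc, hex] at this
  ideal_right r x x' hx := by
    obtain ⟨a, ha, ha'⟩ := (PEquiv.mem_trans _ _ _ _).1 hx
    obtain ⟨e, e', he, -, hxe⟩ := hu x a ha
    obtain ⟨c, hc⟩ := hφ.ideal_right r e e' he
    obtain ⟨d, hd⟩ := hψ.ideal_right c a x' ha'
    refine ⟨d, (PEquiv.mem_trans _ _ _ _).2 ⟨a * c, ?_, hd⟩⟩
    have := hφ.mul _ _ _ _ ha hc
    rwa [← mul_assoc, hxe] at this

theorem isPartialAlgHom_wordSymm (β : A → R ≃. R)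
    (hβ : ∀ x, IsPartialAlgHom K (letterSymm β x))
    (hu : ∀ a x x', x' ∈ letterSymm β a x → ∃ e e', e' ∈ letterSymm β a e ∧ e * x = x ∧ x * e = x)
    (l : List (A × Bool)) : IsPartialAlgHom K (wordSymm β l) := by
  induction l using List.reverseRecOn with
  | nil => exact IsPartialAlgHom.refl
  | append_singleton l x ih =>
    rw [wordSymm_append]
    have : wordSymm β [x] = letterSymm β x := by simp [wordSymm]
    rw [this]
    exact (hβ x).trans ih (hu x)

/-- The partial action of the free group generated by partial symmetries, each of which is an
isomorphism between ideals with (local) units. -/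
noncomputable def ofGenerators (β : A → R ≃. R)
    (hβ : ∀ x, IsPartialAlgHom K (letterSymm β x))
    (hu : ∀ a x x', x' ∈ letterSymm β a x →
      ∃ e e', e' ∈ letterSymm β a e ∧ e * x = x ∧ x * e = x) :
    AlgPartialAction (FreeGroup A) K R :=
  ofPEquiv (freeSymm β) (freeSymm_one β) (freeSymm_inv β) (freeSymm_mul β)
    (fun _ => isPartialAlgHom_wordSymm β hβ hu _)

end FreeGroup

end AlgPartialAction

/-! ## Graphs, paths, Leavitt path algebras -/

/-- A directed graph with vertices `V`, edges `A`, source map `s` and range map `r`. -/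
structure DirGraph (V : Type u) (A : Type v) where
  s : A → V
  r : A → V

namespace DirGraph

variable {V : Type u} {A : Type v} (E : DirGraph V A)

def IsSink (x : V) : Prop := ∀ f, E.s f ≠ x

def IsSource (x : V) : Prop := ∀ f, E.r f ≠ x

def IsIsolated (x : V) : Prop := E.IsSink x ∧ E.IsSource x

def IsInfiniteEmitter (x : V) : Prop := {f | E.s f = x}.Infinite

/-- The generators of the Leavitt path algebra. -/
inductive LeavittGen (V : Type u) (A : Type v) : Type (max u v)
  | vertex : V → LeavittGen V A
  | edge : A → LeavittGen V A
  | ghost : A → LeavittGen V A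

section Leavitt

variable (K : Type w) [Field K]

/-- A generator as an element of the free algebra. -/
def freeGen (x : LeavittGen V A) : FreeAlgebra K (LeavittGen V A) := FreeAlgebra.ι K x

open LeavittGen in
/-- The defining relations of the Leavitt path algebra. -/
inductive LeavittRel :
    FreeAlgebra K (LeavittGen V A) → FreeAlgebra K (LeavittGen V A) → Prop
  | vertex_idem (x : V) :
      LeavittRel (freeGen K (vertex x) * freeGen K (vertex x)) (freeGen K (vertex x))
  | vertex_orth (x y : V) (h : x ≠ y) :
      LeavittRel (freeGen K (vertex x) * freeGen K (vertex y)) 0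
  | source_edge (f : A) :
      LeavittRel (freeGen K (vertex (E.s f)) * freeGen K (edge f)) (freeGen K (edge f))
  | edge_range (f : A) :
      LeavittRel (freeGen K (edge f) * freeGen K (vertex (E.r f))) (freeGen K (edge f))
  | range_ghost (f : A) :
      LeavittRel (freeGen K (vertex (E.r f)) * freeGen K (ghost f)) (freeGen K (ghost f))
  | ghost_source (f : A) :
      LeavittRel (freeGen K (ghost f) * freeGen K (vertex (E.s f))) (freeGen K (ghost f))
  | ghost_edge_self (f : A) :
      LeavittRel (freeGen K (ghost f) * freeGen K (edge f)) (freeGen K (vertex (E.r f)))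
  | ghost_edge_ne (f g : A) (h : f ≠ g) :
      LeavittRel (freeGen K (ghost f) * freeGen K (edge g)) 0
  | vertex_sum (x : V) (hfin : {f | E.s f = x}.Finite) (hne : {f | E.s f = x}.Nonempty) :
      LeavittRel (freeGen K (vertex x))
        (∑ f ∈ hfin.toFinset, freeGen K (edge f) * freeGen K (ghost f))

/-- The image of a generator in the universal unital algebra on the Leavitt relations. -/
noncomputable def leavittGen (x : LeavittGen V A) : RingQuot (E.LeavittRel K) :=
  RingQuot.mkAlgHom K (E.LeavittRel K) (freeGen K x)

/-- The Leavitt path algebra, the universal `K`-algebra (in general without unit) on the Leavitt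
generators and relations. None of the relations involves a constant term, so the universal unital
algebra on them is the unitization of the universal algebra, and the latter is recovered as the
non-unital subalgebra generated by the generators. -/
noncomputable def leavittPathAlgebra : NonUnitalSubalgebra K (RingQuot (E.LeavittRel K)) :=
  NonUnitalAlgebra.adjoin K (Set.range (E.leavittGen K))

end Leavitt

/-- The set `W` of finite paths of nonzero length. -/
structure Path where
  edges : List A
  ne_nil : edges ≠ []
  chain : edges.IsChain fun f g => E.r f = E.s g

variable {E}

namespace Path

def src (a : E.Path) : V := E.s (a.edges.head a.ne_nil)

def rng (a : E.Path) : V := E.r (a.edges.getLast a.ne_nil)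

/-- A path as an element of the free group on the edges. -/
def toGroup (a : E.Path) : FreeGroup A := (a.edges.map FreeGroup.of).prod

end Path

variable (E)

/-- The set `X`: sinks, paths of finite nonzero length that end in a sink, and infinite paths. -/
inductive Boundary : Type (max u v)
  | sink (x : V) (hx : E.IsSink x) : Boundary
  | fin (p : E.Path) (hp : E.IsSink p.rng) : Boundary
  | inf (p : ℕ → A) (hp : ∀ i, E.r (p i) = E.s (p (i + 1))) : Boundary

variable {E}

namespace Boundary

/-- The source of an element of `X`. -/
def src : E.Boundary → V
  | sink x _ => x
  | fin p _ => p.src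
  | inf p _ => E.s (p 0)

/-- The `i`-th edge (counted from `0`) of an element of `X`, if there is one. -/
def edge : E.Boundary → ℕ → Option A
  | sink _ _ => fun _ => none
  | fin p _ => fun i => p.edges[i]?
  | inf p _ => fun i => some (p i)

/-- `ξ` begins with the path `a`. -/
def HasPrefix (ξ : E.Boundary) (a : E.Path) : Prop :=
  ∀ i < a.edges.length, ξ.edge i = a.edges[i]?

open Classical in
/-- The map `θ_{f⁻¹}`, which drops the first edge; it is of interest on elements of `X` that
begin with `f`. -/
noncomputable def shift : E.Boundary → E.Boundary
  | sink x hx => sink x hx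
  | fin p hp =>
    if h : p.edges.tail = [] then sink p.rng hp
    else fin ⟨p.edges.tail, h, p.chain.tail⟩ (by simpa [Path.rng, List.getLast_tail] using hp)
  | inf p hp => inf (fun i => p (i + 1)) fun i => hp (i + 1)

/-- The map `θ_f`, which puts the edge `f` in front of an element of `X` with source `r f`. -/
def cons (f : A) : (ξ : E.Boundary) → ξ.src = E.r f → E.Boundary
  | sink x hx, h => fin ⟨[f], by simp, by simp⟩ (by
      have : x = E.r f := h
      subst this
      simpa [Path.rng] using hx)
  | fin p hp, h => fin ⟨f :: p.edges, by simp, by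
      obtain ⟨l, hl, hc⟩ := p
      obtain ⟨g, l, rfl⟩ := List.exists_cons_of_ne_nil hl
      exact List.isChain_cons_cons.2 ⟨h.symm, hc⟩⟩ (by
        simpa [Path.rng, List.getLast_cons p.ne_nil] using hp)
  | inf p hp, h => inf (fun i => Nat.casesOn i f p) (by
      rintro (_ | i)
      · exact h.symm
      · exact hp i)

theorem ext_edge {ξ η : E.Boundary} (h : ξ.src = η.src) (he : ∀ i, ξ.edge i = η.edge i) :
    ξ = η := by
  have hne : ∀ p : E.Path, p.edges[0]? ≠ none := fun p hp => by
    simp [p.ne_nil] at hp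
  cases ξ with
  | sink x hx =>
    cases η with
    | sink y hy =>
      have : x = y := h
      subst this; rfl
    | fin p hp => exact absurd (he 0).symm (hne p)
    | inf p hp => exact absurd (he 0) (by simp [edge])
  | fin p hp =>
    cases η with
    | sink y hy => exact absurd (he 0) (hne p)
    | fin q hq =>
      have : p.edges = q.edges := List.ext_getElem? he
      obtain ⟨l, h1, h2⟩ := p
      obtain ⟨l', h1', h2'⟩ := q
      obtain rfl : l = l' := this
      rfl
    | inf q hq => exact absurd (he p.edges.length) (by simp [edge])
  | inf p hp =>
    cases η with
    | sink y hy => exact absurd (he 0) (by simp [edge])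
    | fin q hq => exact absurd (he q.edges.length) (by simp [edge])
    | inf q hq =>
      have : p = q := funext fun i => Option.some_injective _ (he i)
      subst this; rfl

theorem edge_cons_zero (f : A) (ξ : E.Boundary) (h) : (cons f ξ h).edge 0 = some f := by
  cases ξ <;> rfl

theorem edge_cons_succ (f : A) (ξ : E.Boundary) (h) (i : ℕ) :
    (cons f ξ h).edge (i + 1) = ξ.edge i := by
  cases ξ <;> rfl

theorem edge_shift (ξ : E.Boundary) (i : ℕ) : ξ.shift.edge i = ξ.edge (i + 1) := by
  cases ξ with
  | sink x hx => rfl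
  | fin p hp =>
    obtain ⟨l, h1, h2⟩ := p
    obtain ⟨g, l, rfl⟩ := List.exists_cons_of_ne_nil h1
    by_cases hl : l = []
    · subst hl; simp [shift, edge]
    · simp [shift, edge, hl]
  | inf p hp => rfl

theorem src_of_edge_zero {ξ : E.Boundary} {f : A} (h : ξ.edge 0 = some f) : ξ.src = E.s f := by
  cases ξ with
  | sink x hx => simp [edge] at h
  | fin p hp =>
    obtain ⟨l, h1, h2⟩ := p
    obtain ⟨g, l, rfl⟩ := List.exists_cons_of_ne_nil h1
    have : g = f := by simpa [edge] using h
    subst this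
    rfl
  | inf p hp =>
    have : p 0 = f := by simpa [edge] using h
    subst this
    rfl

theorem src_shift {ξ : E.Boundary} {f : A} (h : ξ.edge 0 = some f) : ξ.shift.src = E.r f := by
  cases ξ with
  | sink x hx => simp [edge] at h
  | fin p hp =>
    obtain ⟨l, h1, h2⟩ := p
    obtain ⟨g, l, rfl⟩ := List.exists_cons_of_ne_nil h1
    have : g = f := by simpa [edge] using h
    subst this
    by_cases hl : l = []
    · subst hl; simp [shift, src, Path.rng]
    · obtain ⟨g', l, rfl⟩ := List.exists_cons_of_ne_nil hl
      simpa [shift, src, Path.src] using (List.isChain_cons_cons.1 h2).1.symm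
  | inf p hp =>
    have : p 0 = f := by simpa [edge] using h
    subst this
    exact (hp 0).symm

theorem src_cons (f : A) (ξ : E.Boundary) (h) : (cons f ξ h).src = E.s f :=
  src_of_edge_zero (edge_cons_zero f ξ h)

theorem shift_cons (f : A) (ξ : E.Boundary) (h) : (cons f ξ h).shift = ξ :=
  ext_edge ((src_shift (edge_cons_zero f ξ h)).trans h.symm) fun i => by
    rw [edge_shift, edge_cons_succ]

theorem cons_shift (f : A) (ξ : E.Boundary) (h : ξ.edge 0 = some f) :
    cons f ξ.shift (src_shift h) = ξ :=
  ext_edge ((src_cons _ _ _).trans (src_of_edge_zero h).symm) fun i => by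
    cases i with
    | zero => rw [edge_cons_zero, h]
    | succ i => rw [edge_cons_succ, edge_shift]

theorem exists_edge_of_not_isSink {ξ : E.Boundary} (h : ¬ E.IsSink ξ.src) :
    ∃ f, ξ.edge 0 = some f := by
  cases ξ with
  | sink x hx => exact absurd hx h
  | fin p hp => exact ⟨p.edges.head p.ne_nil, by simp [edge, List.head?_eq_some_head p.ne_nil,
      ← List.head?_eq_getElem?]⟩
  | inf p hp => exact ⟨p 0, rfl⟩

end Boundary

/-! ## The sets `X_g` and the algebra of functions -/

variable (E)

/-- The subset `X_g` of `X`: everything for `g = 1`, the elements with source `r b` for `g = b⁻¹`,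
the elements beginning with `a` for `g = a` and for a reduced `g = a b⁻¹` with `r a = r b`, and the
empty set for all other `g`. (In normal form, `a b⁻¹` is reduced when the last edges differ.) -/
def cyl (g : FreeGroup A) : Set E.Boundary :=
  {ξ | g = 1 ∨
    (∃ b : E.Path, g = b.toGroup⁻¹ ∧ ξ.src = b.rng) ∨
    (∃ a : E.Path, g = a.toGroup ∧ ξ.HasPrefix a) ∨
    (∃ a b : E.Path, a.rng = b.rng ∧ a.edges.getLast a.ne_nil ≠ b.edges.getLast b.ne_nil ∧
      g = a.toGroup * b.toGroup⁻¹ ∧ ξ.HasPrefix a)}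

variable (K : Type w) [Field K]

/-- The characteristic function `1_g` of `X_g`. -/
noncomputable def one (g : FreeGroup A) : E.Boundary → K := (E.cyl g).indicator 1

/-- The formal series `∑ 1_f` over the edges `f` with `s f = x`. At each point of `X` at most one of
its terms is different from zero, and the series is identified with the function that is its
pointwise sum. -/
noncomputable def emitterSeries (x : V) : E.Boundary → K :=
  fun ξ => ∑ᶠ f : {f // E.s f = x}, E.one K (FreeGroup.of (f : A)) ξ

/-- The spanning set of `D^s(X)`. -/
def generators : Set (E.Boundary → K) :=
  {φ | ∃ g : FreeGroup A, g ≠ 1 ∧ φ = E.one K g} ∪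
    {φ | ∃ x, E.IsInfiniteEmitter x ∧ φ = E.emitterSeries K x}

/-! ### Normal forms -/

section Words

/-- The word `l l'⁻¹`. -/
def quotWord (l l' : List A) : List (A × Bool) :=
  l.map (fun f => (f, true)) ++ (l'.map (fun f => (f, false))).reverse

theorem quotWord_injective {l₁ l₁' l₂ l₂' : List A} (h : quotWord l₁ l₁' = quotWord l₂ l₂') :
    l₁ = l₂ ∧ l₁' = l₂' := by
  have h1 : ∀ l l' : List A,
      (quotWord l l').filterMap (fun x => if x.2 then some x.1 else none) = l := by
    intro l l'
    simp [quotWord, List.filterMap_append, List.filterMap_map, List.filterMap_reverse]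
  have h2 : ∀ l l' : List A,
      ((quotWord l l').filterMap (fun x => if x.2 then none else some x.1)).reverse = l' := by
    intro l l'
    simp [quotWord, List.filterMap_append, List.filterMap_map, List.filterMap_reverse]
  exact ⟨by rw [← h1 l₁ l₁', h, h1], by rw [← h2 l₁ l₁', h, h2]⟩

theorem mk_quotWord (l l' : List A) :
    FreeGroup.mk (quotWord l l') = (l.map FreeGroup.of).prod * ((l'.map FreeGroup.of).prod)⁻¹ := by
  have h : ∀ l : List A, (l.map FreeGroup.of).prod = FreeGroup.mk (l.map (fun f => (f, true))) := by
    intro l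
    induction l with
    | nil => rfl
    | cons f l ih => simp [ih, FreeGroup.of]
  rw [h, h, FreeGroup.inv_mk, FreeGroup.mul_mk]
  simp [quotWord, FreeGroup.invRev, Function.comp_def]

theorem isReduced_map_const (l : List A) (b : Bool) :
    FreeGroup.IsReduced (l.map (fun f => (f, b))) := by
  rw [FreeGroup.IsReduced, List.isChain_map]
  induction l with
  | nil => exact List.isChain_nil
  | cons x l ih => exact List.IsChain.cons ih (fun _ _ _ => rfl)

theorem isReduced_quotWord (l l' : List A)
    (h : ∀ f ∈ l.getLast?, ∀ g ∈ l'.getLast?, f ≠ g) :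
    FreeGroup.IsReduced (quotWord l l') := by
  refine List.isChain_append.2 ⟨isReduced_map_const l true, ?_, ?_⟩
  · rw [← List.map_reverse]
    exact isReduced_map_const _ false
  · intro x hx y hy hxy
    simp only [List.getLast?_map, List.head?_reverse, Option.mem_def, Option.map_eq_some_iff]
      at hx hy
    obtain ⟨f, hf, rfl⟩ := hx
    obtain ⟨g, hg, rfl⟩ := hy
    exact absurd hxy (h f hf g hg)

open Classical in
theorem toWord_quot (l l' : List A) (h : ∀ f ∈ l.getLast?, ∀ g ∈ l'.getLast?, f ≠ g) :
    ((l.map FreeGroup.of).prod * ((l'.map FreeGroup.of).prod)⁻¹).toWord = quotWord l l' := by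
  rw [← mk_quotWord, FreeGroup.toWord_mk, (isReduced_quotWord l l' h).reduce_eq]

theorem quot_injective {l₁ l₁' l₂ l₂' : List A}
    (h₁ : ∀ f ∈ l₁.getLast?, ∀ g ∈ l₁'.getLast?, f ≠ g)
    (h₂ : ∀ f ∈ l₂.getLast?, ∀ g ∈ l₂'.getLast?, f ≠ g)
    (h : (l₁.map FreeGroup.of).prod * ((l₁'.map FreeGroup.of).prod)⁻¹ =
      (l₂.map FreeGroup.of).prod * ((l₂'.map FreeGroup.of).prod)⁻¹) :
    l₁ = l₂ ∧ l₁' = l₂' := by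
  classical
  apply quotWord_injective
  rw [← toWord_quot _ _ h₁, ← toWord_quot _ _ h₂, h]

end Words

section Cylinders

variable {E}

theorem Path.ext_edges {a b : E.Path} (h : a.edges = b.edges) : a = b := by
  cases a; cases b; simpa using h

/-- The elements of `X` with a given initial word (of any length) and, for the empty word, a
condition on the source. -/
theorem mem_cyl_quot {l l' : List A} (h : ∀ f ∈ l.getLast?, ∀ g ∈ l'.getLast?, f ≠ g)
    (ξ : E.Boundary) :
    ξ ∈ E.cyl ((l.map FreeGroup.of).prod * ((l'.map FreeGroup.of).prod)⁻¹) ↔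
      (l = [] ∧ l' = []) ∨
      (∃ b : E.Path, l = [] ∧ l' = b.edges ∧ ξ.src = b.rng) ∨
      (∃ a : E.Path, l = a.edges ∧ l' = [] ∧ ξ.HasPrefix a) ∨
      (∃ a b : E.Path, a.rng = b.rng ∧ l = a.edges ∧ l' = b.edges ∧ ξ.HasPrefix a) := by
  constructor
  · rintro (h1 | ⟨b, hb, hs⟩ | ⟨a, ha, hp⟩ | ⟨a, b, hr, hl, hab, hp⟩)
    · exact Or.inl (quot_injective (l₂ := []) (l₂' := []) h (by simp) (by simpa using h1))
    · have := quot_injective (l₂ := []) (l₂' := b.edges) h (by simp)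
        (by simpa [Path.toGroup] using hb)
      exact Or.inr (Or.inl ⟨b, this.1, this.2, hs⟩)
    · have := quot_injective (l₂ := a.edges) (l₂' := []) h (by simp)
        (by simpa [Path.toGroup] using ha)
      exact Or.inr (Or.inr (Or.inl ⟨a, this.1, this.2, hp⟩))
    · have := quot_injective (l₂ := a.edges) (l₂' := b.edges) h
        (by simpa [List.getLast?_eq_some_getLast a.ne_nil, List.getLast?_eq_some_getLast b.ne_nil]
          using hl) hab
      exact Or.inr (Or.inr (Or.inr ⟨a, b, hr, this.1, this.2, hp⟩))
  · rintro (⟨rfl, rfl⟩ | ⟨b, rfl, rfl, hs⟩ | ⟨a, rfl, rfl, hp⟩ | ⟨a, b, hr, rfl, rfl, hp⟩)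
    · exact Or.inl (by simp)
    · exact Or.inr (Or.inl ⟨b, by simp [Path.toGroup], hs⟩)
    · exact Or.inr (Or.inr (Or.inl ⟨a, by simp [Path.toGroup], hp⟩))
    · refine Or.inr (Or.inr (Or.inr ⟨a, b, hr, ?_, rfl, hp⟩))
      exact h _ (by simp [List.getLast?_eq_some_getLast a.ne_nil]) _
        (by simp [List.getLast?_eq_some_getLast b.ne_nil])

theorem cyl_toGroup (a : E.Path) : E.cyl a.toGroup = {ξ | ξ.HasPrefix a} := by
  ext ξ
  have := mem_cyl_quot (l := a.edges) (l' := []) (by simp) ξ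
  simp only [List.map_nil, List.prod_nil, inv_one, mul_one] at this
  refine this.trans ?_
  constructor
  · rintro (⟨h, -⟩ | ⟨b, h, -⟩ | ⟨b, h, -, hp⟩ | ⟨c, b, -, -, h, -⟩)
    · exact absurd h a.ne_nil
    · exact absurd h a.ne_nil
    · rwa [Path.ext_edges h]
    · exact absurd h.symm b.ne_nil
  · exact fun h => Or.inr (Or.inr (Or.inl ⟨a, rfl, trivial, h⟩))

theorem cyl_toGroup_inv (b : E.Path) : E.cyl (b.toGroup)⁻¹ = {ξ | ξ.src = b.rng} := by
  ext ξ
  have := mem_cyl_quot (l := []) (l' := b.edges) (by simp) ξ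
  simp only [List.map_nil, List.prod_nil, one_mul] at this
  refine this.trans ?_
  constructor
  · rintro (⟨-, h⟩ | ⟨c, -, h, hs⟩ | ⟨c, -, h, hp⟩ | ⟨c, d, -, h, -, -⟩)
    · exact absurd h b.ne_nil
    · rwa [Path.ext_edges h]
    · exact absurd h b.ne_nil
    · exact absurd h.symm c.ne_nil
  · exact fun h => Or.inr (Or.inl ⟨b, trivial, rfl, h⟩)

theorem cyl_toGroup_mul_inv (a b : E.Path) (hr : a.rng = b.rng)
    (hl : a.edges.getLast a.ne_nil ≠ b.edges.getLast b.ne_nil) :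
    E.cyl (a.toGroup * (b.toGroup)⁻¹) = {ξ | ξ.HasPrefix a} := by
  ext ξ
  have := mem_cyl_quot (l := a.edges) (l' := b.edges)
    (by simpa [List.getLast?_eq_some_getLast a.ne_nil, List.getLast?_eq_some_getLast b.ne_nil]
          using hl) ξ
  refine this.trans ?_
  constructor
  · rintro (⟨h, -⟩ | ⟨c, h, -⟩ | ⟨c, -, h, -⟩ | ⟨c, d, -, h, -, hp⟩)
    · exact absurd h a.ne_nil
    · exact absurd h a.ne_nil
    · exact absurd h b.ne_nil
    · rwa [Path.ext_edges h]
  · exact fun h => Or.inr (Or.inr (Or.inr ⟨a, b, hr, rfl, rfl, h⟩))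

variable (E) in
/-- The path that consists of one edge. -/
def edgePath (f : A) : E.Path := ⟨[f], by simp, by simp⟩

theorem toGroup_edgePath (f : A) : (E.edgePath f).toGroup = FreeGroup.of f := by
  simp [Path.toGroup, edgePath]

theorem mem_cyl_of (f : A) (ξ : E.Boundary) :
    ξ ∈ E.cyl (FreeGroup.of f) ↔ ξ.edge 0 = some f := by
  rw [← toGroup_edgePath (E := E), cyl_toGroup]
  simp [Boundary.HasPrefix, edgePath]

theorem mem_cyl_of_inv (f : A) (ξ : E.Boundary) :
    ξ ∈ E.cyl (FreeGroup.of f)⁻¹ ↔ ξ.src = E.r f := by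
  rw [← toGroup_edgePath (E := E), cyl_toGroup_inv]
  simp [Path.rng, edgePath]

theorem emitterSeries_eq {x : V} (hx : ¬ E.IsSink x) :
    E.emitterSeries K x = {ξ : E.Boundary | ξ.src = x}.indicator 1 := by
  funext ξ
  by_cases h : ξ.src = x
  · subst h
    obtain ⟨f, hf⟩ := Boundary.exists_edge_of_not_isSink hx
    rw [Set.indicator_of_mem (by simp), emitterSeries,
      finsum_eq_single _ (⟨f, (Boundary.src_of_edge_zero hf).symm⟩ : {g // E.s g = ξ.src})]
    · rw [one, Set.indicator_of_mem ((mem_cyl_of f ξ).2 hf)]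
    · rintro ⟨g, hg⟩ hne
      refine Set.indicator_of_notMem (fun hm => hne ?_) _
      rw [mem_cyl_of, hf] at hm
      exact Subtype.ext (Option.some_injective _ hm).symm
  · rw [Set.indicator_of_notMem (by simpa using h), emitterSeries]
    refine finsum_eq_zero_of_forall_eq_zero ?_
    rintro ⟨g, rfl⟩
    refine Set.indicator_of_notMem (fun hm => h ?_) _
    exact Boundary.src_of_edge_zero ((mem_cyl_of g ξ).1 hm)

variable (E) in
/-- The sets whose characteristic functions span `D^s(X)`. -/
inductive IsBasic : Set E.Boundary → Prop
  | empty : IsBasic ∅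
  | pre (a : E.Path) : IsBasic {ξ | ξ.HasPrefix a}
  | src (x : V) (hx : (∃ f, E.r f = x) ∨ E.IsInfiniteEmitter x) : IsBasic {ξ | ξ.src = x}

theorem HasPrefix.edge_zero {ξ : E.Boundary} {a : E.Path} (h : ξ.HasPrefix a) :
    ξ.edge 0 = some (a.edges.head a.ne_nil) := by
  rw [h 0 (List.length_pos_iff.2 a.ne_nil), ← List.head?_eq_getElem?,
    List.head?_eq_some_head a.ne_nil]

theorem IsBasic.inter {S T : Set E.Boundary} (hS : E.IsBasic S) (hT : E.IsBasic T) :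
    E.IsBasic (S ∩ T) := by
  have key : ∀ S T : Set E.Boundary, E.IsBasic S → E.IsBasic T →
      ((S ∩ T).Nonempty → S ⊆ T ∨ T ⊆ S) → E.IsBasic (S ∩ T) := by
    intro S T hS hT h
    rcases (S ∩ T).eq_empty_or_nonempty with h0 | h0
    · rw [h0]; exact .empty
    · rcases h h0 with h1 | h1
      · rwa [Set.inter_eq_left.2 h1]
      · rwa [Set.inter_eq_right.2 h1]
  have hpre : ∀ (a b : E.Path) (ξ : E.Boundary), a.edges.length ≤ b.edges.length →
      ξ.HasPrefix a → ξ.HasPrefix b → {ξ : E.Boundary | ξ.HasPrefix b} ⊆ {ξ | ξ.HasPrefix a} := by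
    intro a b ξ hl ha hb η hη i hi
    rw [hη i (by omega), ← hb i (by omega), ha i hi]
  have hsrc : ∀ (a : E.Path) (x : V) (ξ : E.Boundary), ξ.HasPrefix a → ξ.src = x →
      {ξ : E.Boundary | ξ.HasPrefix a} ⊆ {ξ | ξ.src = x} := by
    intro a x ξ ha hx η hη
    rw [← hx, Set.mem_ofPred_eq, Boundary.src_of_edge_zero (HasPrefix.edge_zero hη),
      Boundary.src_of_edge_zero (HasPrefix.edge_zero ha)]
  refine key S T hS hT ?_
  rintro ⟨ξ, h1, h2⟩
  cases hS with
  | empty => exact h1.elim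
  | pre a =>
    cases hT with
    | empty => exact h2.elim
    | pre b =>
      rcases le_total a.edges.length b.edges.length with h | h
      · exact Or.inr (hpre a b ξ h h1 h2)
      · exact Or.inl (hpre b a ξ h h2 h1)
    | src x hx => exact Or.inl (hsrc a x ξ h1 h2)
  | src x hx =>
    cases hT with
    | empty => exact h2.elim
    | pre b => exact Or.inr (hsrc b x ξ h2 h1)
    | src y hy =>
      have : x = y := h1.symm.trans h2
      subst this
      exact Or.inl subset_rfl

theorem span_generators : Submodule.span K (E.generators K) =
    Submodule.span K {φ | ∃ S, E.IsBasic S ∧ φ = S.indicator 1} := by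
  apply le_antisymm
  · refine Submodule.span_le.2 ?_
    rintro φ (⟨g, hg, rfl⟩ | ⟨x, hx, rfl⟩)
    · have hb : E.IsBasic (E.cyl g) := by
        rcases (E.cyl g).eq_empty_or_nonempty with h0 | ⟨ξ, hξ⟩
        · rw [h0]; exact .empty
        · rcases hξ with h | ⟨b, rfl, -⟩ | ⟨a, rfl, -⟩ | ⟨a, b, hr, hl, rfl, -⟩
          · exact absurd h hg
          · rw [cyl_toGroup_inv]; exact .src _ (Or.inl ⟨_, rfl⟩)
          · rw [cyl_toGroup]; exact .pre a
          · rw [cyl_toGroup_mul_inv a b hr hl]; exact .pre a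
      exact Submodule.subset_span ⟨_, hb, rfl⟩
    · refine Submodule.subset_span ⟨_, .src x (Or.inr hx), emitterSeries_eq K fun hs => ?_⟩
      obtain ⟨f, hf⟩ := hx.nonempty
      exact hs f hf
  · refine Submodule.span_le.2 ?_
    rintro φ ⟨S, hS, rfl⟩
    have hne : ∀ a : E.Path, a.toGroup ≠ 1 := fun a h => by
      have := quot_injective (l₁ := a.edges) (l₁' := []) (l₂ := []) (l₂' := []) (by simp) (by simp)
        (by simpa [Path.toGroup] using h)
      exact a.ne_nil this.1
    cases hS with
    | empty => rw [Set.indicator_empty]; exact Submodule.zero_mem _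
    | pre a =>
      rw [← cyl_toGroup]
      exact Submodule.subset_span (Or.inl ⟨_, hne a, rfl⟩)
    | src x hx =>
      rcases hx with ⟨f, rfl⟩ | hx
      · have : {ξ : E.Boundary | ξ.src = E.r f} = E.cyl ((E.edgePath f).toGroup)⁻¹ := by
          ext ξ
          rw [toGroup_edgePath, mem_cyl_of_inv]; rfl
        rw [this]
        exact Submodule.subset_span (Or.inl ⟨_, by simpa using hne _, rfl⟩)
      · rw [← emitterSeries_eq K fun hs => ?_]
        · exact Submodule.subset_span (Or.inr ⟨x, hx, rfl⟩)
        · obtain ⟨f, hf⟩ := hx.nonempty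
          exact hs f hf

end Cylinders

/-- The algebra `D^s(X)`: the linear span of the functions `1_g`, for `g ≠ 1`, and of the formal
series attached to the infinite emitters. -/
noncomputable def DsX : NonUnitalSubalgebra K (E.Boundary → K) where
  toSubmodule := Submodule.span K (E.generators K)
  mul_mem' := by
    intro φ ψ hφ hψ
    change φ ∈ Submodule.span K _ at hφ
    change ψ ∈ Submodule.span K _ at hψ
    change φ * ψ ∈ Submodule.span K _
    rw [span_generators] at *
    have := Submodule.mul_mem_mul hφ hψ
    rw [Submodule.span_mul_span] at this
    refine Submodule.span_mono ?_ this
    rintro _ ⟨_, ⟨S, hS, rfl⟩, _, ⟨T, hT, rfl⟩, rfl⟩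
    exact ⟨S ∩ T, hS.inter hT, by simp [Set.inter_indicator_one]⟩

/-! ## The partial action `β` -/

theorem indicator_mem_DsX {S : Set E.Boundary} (hS : E.IsBasic S) :
    (S.indicator 1 : E.Boundary → K) ∈ E.DsX K := by
  change _ ∈ Submodule.span K (E.generators K)
  rw [span_generators]
  exact Submodule.subset_span ⟨S, hS, rfl⟩

theorem map_mem_DsX (F : (E.Boundary → K) →ₗ[K] (E.Boundary → K))
    (hF : ∀ S, E.IsBasic S → ∃ T, E.IsBasic T ∧ F (S.indicator 1) = T.indicator 1)
    {φ : E.Boundary → K} (hφ : φ ∈ E.DsX K) : F φ ∈ E.DsX K := by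
  change φ ∈ Submodule.span K (E.generators K) at hφ
  change F φ ∈ Submodule.span K (E.generators K)
  rw [span_generators] at *
  have := Submodule.mem_map_of_mem (f := F) hφ
  rw [Submodule.map_span] at this
  refine Submodule.span_mono ?_ this
  rintro _ ⟨_, ⟨S, hS, rfl⟩, rfl⟩
  exact hF S hS

open Classical in
/-- The linear map `F(X_{f⁻¹}) → F(X_f)`, `φ ↦ φ ∘ θ_{f⁻¹}`, where functions on `X_f` are extended
by zero. -/
noncomputable def push (f : A) : (E.Boundary → K) →ₗ[K] (E.Boundary → K) where
  toFun φ ξ := if ξ ∈ E.cyl (FreeGroup.of f) then φ ξ.shift else 0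
  map_add' φ ψ := by ext ξ; by_cases h : ξ ∈ E.cyl (FreeGroup.of f) <;> simp [h]
  map_smul' k φ := by ext ξ; by_cases h : ξ ∈ E.cyl (FreeGroup.of f) <;> simp [h]

open Classical in
/-- The linear map `F(X_f) → F(X_{f⁻¹})`, `φ ↦ φ ∘ θ_f`, where functions on `X_{f⁻¹}` are extended
by zero; recall that `X_{f⁻¹}` is the set of all elements of `X` with source `r f`. -/
noncomputable def pull (f : A) : (E.Boundary → K) →ₗ[K] (E.Boundary → K) where
  toFun φ ξ := if h : ξ.src = E.r f then φ (ξ.cons f h) else 0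
  map_add' φ ψ := by ext ξ; by_cases h : ξ.src = E.r f <;> simp [h]
  map_smul' k φ := by ext ξ; by_cases h : ξ.src = E.r f <;> simp [h]

variable {E} {K}

theorem push_indicator (f : A) (S : Set E.Boundary) : E.push K f (S.indicator 1) =
    {ξ : E.Boundary | ξ.edge 0 = some f ∧ ξ.shift ∈ S}.indicator 1 := by
  classical
  ext ξ
  simp only [push, LinearMap.coe_mk, AddHom.coe_mk, mem_cyl_of, Set.indicator_apply,
    Set.mem_ofPred_eq]
  by_cases h : ξ.edge 0 = some f <;> simp [h]

theorem pull_indicator (f : A) (S : Set E.Boundary) : E.pull K f (S.indicator 1) =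
    {ξ : E.Boundary | ∃ h : ξ.src = E.r f, ξ.cons f h ∈ S}.indicator 1 := by
  classical
  ext ξ
  simp only [pull, LinearMap.coe_mk, AddHom.coe_mk, Set.indicator_apply, Set.mem_ofPred_eq]
  by_cases h : ξ.src = E.r f <;> simp [h]

theorem push_mem (f : A) {φ : E.Boundary → K} (hφ : φ ∈ E.DsX K) : E.push K f φ ∈ E.DsX K := by
  refine E.map_mem_DsX K _ (fun S hS => ⟨_, ?_, push_indicator f S⟩) hφ
  cases hS with
  | empty => simpa using IsBasic.empty
  | pre a =>
    by_cases h : E.r f = a.src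
    · have hc : (f :: a.edges).IsChain fun f g => E.r f = E.s g := by
        refine List.IsChain.cons a.chain fun y hy => ?_
        rw [List.head?_eq_some_head a.ne_nil, Option.mem_some_iff] at hy
        rw [← hy]; exact h
      convert IsBasic.pre (⟨f :: a.edges, by simp, hc⟩ : E.Path) using 1
      ext ξ
      constructor
      · rintro ⟨h0, hs⟩ (_ | i) hi
        · simpa using h0
        · rw [← Boundary.edge_shift, hs i (by simpa using hi)]; simp
      · intro hp
        refine ⟨by simpa using hp 0 (by simp), fun i hi => ?_⟩
        rw [Boundary.edge_shift, hp (i + 1) (by simpa using hi)]; simp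
    · convert IsBasic.empty using 1
      refine Set.eq_empty_of_forall_notMem ?_
      rintro ξ ⟨h0, hs⟩
      apply h
      rw [← Boundary.src_shift h0, Boundary.src_of_edge_zero (HasPrefix.edge_zero hs)]
      rfl
  | src x hx =>
    by_cases h : E.r f = x
    · convert IsBasic.pre (E.edgePath f) using 1
      ext ξ
      constructor
      · rintro ⟨h0, hs⟩
        simpa [Boundary.HasPrefix, edgePath] using h0
      · intro hp
        have h0 : ξ.edge 0 = some f := by simpa [Boundary.HasPrefix, edgePath] using hp
        exact ⟨h0, (Boundary.src_shift h0).trans h⟩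
    · convert IsBasic.empty using 1
      refine Set.eq_empty_of_forall_notMem ?_
      rintro ξ ⟨h0, hs⟩
      exact h ((Boundary.src_shift h0).symm.trans hs)

theorem pull_mem (f : A) {φ : E.Boundary → K} (hφ : φ ∈ E.DsX K) : E.pull K f φ ∈ E.DsX K := by
  refine E.map_mem_DsX K _ (fun S hS => ⟨_, ?_, pull_indicator f S⟩) hφ
  have hr : E.IsBasic {ξ | ξ.src = E.r f} := .src _ (Or.inl ⟨f, rfl⟩)
  cases hS with
  | empty => simpa using IsBasic.empty
  | pre a =>
    obtain ⟨l, hl, hc⟩ := a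
    obtain ⟨g, l, rfl⟩ := List.exists_cons_of_ne_nil hl
    by_cases h : g = f
    · subst h
      by_cases hl' : l = []
      · subst hl'
        convert hr using 1
        ext ξ
        refine ⟨fun h => h.1, fun h => ⟨h, fun i hi => ?_⟩⟩
        obtain rfl : i = 0 := by simpa using hi
        simp [Boundary.edge_cons_zero]
      · convert hr.inter (IsBasic.pre (⟨l, hl', hc.tail⟩ : E.Path)) using 1
        ext ξ
        constructor
        · rintro ⟨h, hp⟩
          refine ⟨h, fun i hi => ?_⟩
          rw [← Boundary.edge_cons_succ g ξ h, hp (i + 1) (by simpa using hi)]; simp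
        · rintro ⟨h, hp⟩
          refine ⟨h, ?_⟩
          rintro (_ | i) hi
          · simp [Boundary.edge_cons_zero]
          · rw [Boundary.edge_cons_succ, hp i (by simpa using hi)]; simp
    · convert IsBasic.empty using 1
      refine Set.eq_empty_of_forall_notMem ?_
      rintro ξ ⟨h', hp⟩
      have := hp 0 (by simp)
      rw [Boundary.edge_cons_zero] at this
      exact h (by simpa using this.symm)
  | src x hx =>
    by_cases h : E.s f = x
    · convert hr using 1
      ext ξ
      exact ⟨fun h => h.1, fun h' => ⟨h', (Boundary.src_cons _ _ _).trans h⟩⟩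
    · convert IsBasic.empty using 1
      refine Set.eq_empty_of_forall_notMem ?_
      rintro ξ ⟨h', hp⟩
      exact h ((Boundary.src_cons _ _ _).symm.trans hp)

theorem of_ne_one (f : A) : FreeGroup.of f ≠ 1 := by
  simp

variable (E K)

theorem one_mem (g : FreeGroup A) (hg : g ≠ 1) : E.one K g ∈ E.DsX K :=
  Submodule.subset_span (Or.inl ⟨g, hg, rfl⟩)

/-- The set `1_g D^s(X)`, for `g = f` or `g = f⁻¹`. -/
def oneMul (g : FreeGroup A) : Set (E.DsX K) :=
  {φ | ∃ ψ : E.DsX K, (φ : E.Boundary → K) = E.one K g * (ψ : E.Boundary → K)}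

variable {E K}

theorem one_mul_one (g : FreeGroup A) : E.one K g * E.one K g = E.one K g := by
  ext ξ
  by_cases h : ξ ∈ E.cyl g <;> simp [one, h]

theorem mem_oneMul_iff (g : FreeGroup A) (φ : E.DsX K) :
    φ ∈ E.oneMul K g ↔ E.one K g * (φ : E.Boundary → K) = φ := by
  constructor
  · rintro ⟨ψ, hψ⟩
    rw [hψ, ← mul_assoc, one_mul_one]
  · exact fun h => ⟨φ, h.symm⟩

theorem one_mul_push (f : A) (φ : E.Boundary → K) :
    E.one K (FreeGroup.of f) * E.push K f φ = E.push K f φ := by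
  ext ξ
  by_cases h : ξ ∈ E.cyl (FreeGroup.of f) <;> simp [one, push, h]

theorem one_mul_pull (f : A) (φ : E.Boundary → K) :
    E.one K (FreeGroup.of f)⁻¹ * E.pull K f φ = E.pull K f φ := by
  ext ξ
  by_cases h : ξ.src = E.r f
  · have : ξ ∈ E.cyl (FreeGroup.of f)⁻¹ := (mem_cyl_of_inv f ξ).2 h
    simp [one, this]
  · simp [pull, h]

theorem pull_push (f : A) (φ : E.Boundary → K) :
    E.pull K f (E.push K f φ) = E.one K (FreeGroup.of f)⁻¹ * φ := by
  ext ξ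
  by_cases h : ξ.src = E.r f
  · have h1 : ξ ∈ E.cyl (FreeGroup.of f)⁻¹ := (mem_cyl_of_inv f ξ).2 h
    have h2 : ξ.cons f h ∈ E.cyl (FreeGroup.of f) :=
      (mem_cyl_of _ _).2 (Boundary.edge_cons_zero _ _ _)
    simp [one, h1, pull, push, h, h2, Boundary.shift_cons]
  · have h1 : ξ ∉ E.cyl (FreeGroup.of f)⁻¹ := fun hm => h ((mem_cyl_of_inv f ξ).1 hm)
    simp [one, h1, pull, h]

theorem push_pull (f : A) (φ : E.Boundary → K) :
    E.push K f (E.pull K f φ) = E.one K (FreeGroup.of f) * φ := by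
  ext ξ
  by_cases h : ξ ∈ E.cyl (FreeGroup.of f)
  · have h1 := (mem_cyl_of f ξ).1 h
    simp [one, h, pull, push, Boundary.src_shift h1, Boundary.cons_shift f ξ h1]
  · simp [one, h, push]

theorem push_mul (f : A) (φ ψ : E.Boundary → K) :
    E.push K f (φ * ψ) = E.push K f φ * E.push K f ψ := by
  ext ξ
  by_cases h : ξ ∈ E.cyl (FreeGroup.of f) <;> simp [push, h]

theorem pull_mul (f : A) (φ ψ : E.Boundary → K) :
    E.pull K f (φ * ψ) = E.pull K f φ * E.pull K f ψ := by
  ext ξ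
  by_cases h : ξ.src = E.r f <;> simp [pull, h]

variable (E K)

open Classical in
/-- The partial symmetry `β_f` of `D^s(X)`, from `1_{f⁻¹} D^s(X)` onto `1_f D^s(X)`. It maps
`1_{f⁻¹} 1_h` to `1_f 1_{f h}`, see `edgeSymm_one`. -/
noncomputable def edgeSymm (f : A) : E.DsX K ≃. E.DsX K where
  toFun φ :=
    if φ ∈ E.oneMul K (FreeGroup.of f)⁻¹ then some ⟨E.push K f φ, push_mem f φ.2⟩ else none
  invFun φ :=
    if φ ∈ E.oneMul K (FreeGroup.of f) then some ⟨E.pull K f φ, pull_mem f φ.2⟩ else none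
  inv φ ψ := by
    simp only [Option.ite_none_right_eq_some, Option.some.injEq]
    constructor
    · rintro ⟨h, rfl⟩
      refine ⟨(mem_oneMul_iff _ _).2 (one_mul_pull f _), Subtype.ext ?_⟩
      exact (push_pull f _).trans ((mem_oneMul_iff _ _).1 h)
    · rintro ⟨h, rfl⟩
      refine ⟨(mem_oneMul_iff _ _).2 (one_mul_push f _), Subtype.ext ?_⟩
      exact (pull_push f _).trans ((mem_oneMul_iff _ _).1 h)

variable {E K}

theorem mem_edgeSymm (f : A) (φ ψ : E.DsX K) : ψ ∈ E.edgeSymm K f φ ↔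
    φ ∈ E.oneMul K (FreeGroup.of f)⁻¹ ∧ E.push K f φ = ψ := by
  classical
  change ψ ∈ (if φ ∈ E.oneMul K (FreeGroup.of f)⁻¹ then
    some (⟨E.push K f φ, push_mem f φ.2⟩ : E.DsX K) else none) ↔ _
  simp [Option.mem_def, Subtype.ext_iff]

theorem mem_edgeSymm_symm (f : A) (φ ψ : E.DsX K) : ψ ∈ (E.edgeSymm K f).symm φ ↔
    φ ∈ E.oneMul K (FreeGroup.of f) ∧ E.pull K f φ = ψ := by
  classical
  change ψ ∈ (if φ ∈ E.oneMul K (FreeGroup.of f) then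
    some (⟨E.pull K f φ, pull_mem f φ.2⟩ : E.DsX K) else none) ↔ _
  simp [Option.mem_def, Subtype.ext_iff]

theorem isPartialAlgHom_aux (φ : E.DsX K ≃. E.DsX K) (g : FreeGroup A)
    (F : (E.Boundary → K) →ₗ[K] (E.Boundary → K)) (hF : ∀ x y, F (x * y) = F x * F y)
    (hmem : ∀ x ∈ E.DsX K, F x ∈ E.DsX K)
    (h : ∀ x y, y ∈ φ x ↔ x ∈ E.oneMul K g ∧ F x = y) :
    AlgPartialAction.IsPartialAlgHom K φ where
  zero := (h _ _).2 ⟨(mem_oneMul_iff _ _).2 (by simp), by simp⟩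
  add x y x' y' hx hy := by
    rw [h, mem_oneMul_iff] at *
    exact ⟨by simp [mul_add, hx.1, hy.1], by simp [hx.2, hy.2]⟩
  smul k x x' hx := by
    rw [h, mem_oneMul_iff] at *
    exact ⟨by simp [hx.1], by simp [hx.2]⟩
  mul x y x' y' hx hy := by
    rw [h, mem_oneMul_iff] at *
    exact ⟨by simp [← mul_assoc, hx.1], by simp [hx.2, hy.2, hF]⟩
  ideal_left r x x' hx := by
    refine ⟨⟨_, hmem _ (r * x).2⟩, ?_⟩
    rw [h, mem_oneMul_iff] at *
    refine ⟨?_, rfl⟩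
    change _ * ((r : E.Boundary → K) * (x : E.Boundary → K)) = r * x
    rw [mul_left_comm, hx.1]
  ideal_right r x x' hx := by
    refine ⟨⟨_, hmem _ (x * r).2⟩, ?_⟩
    rw [h, mem_oneMul_iff] at *
    refine ⟨?_, rfl⟩
    change _ * ((x : E.Boundary → K) * (r : E.Boundary → K)) = x * r
    rw [← mul_assoc, hx.1]

theorem isPartialAlgHom_edgeSymm (x : A × Bool) :
    AlgPartialAction.IsPartialAlgHom K (AlgPartialAction.letterSymm (E.edgeSymm K) x) := by
  obtain ⟨f, b⟩ := x
  cases b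
  · exact isPartialAlgHom_aux _ _ (E.pull K f) (pull_mul f) (fun _ h => pull_mem f h)
      (mem_edgeSymm_symm f)
  · exact isPartialAlgHom_aux _ _ (E.push K f) (push_mul f) (fun _ h => push_mem f h)
      (mem_edgeSymm f)

theorem unit_aux (φ : E.DsX K ≃. E.DsX K) (g : FreeGroup A) (hg : g ≠ 1)
    (F : (E.Boundary → K) → (E.Boundary → K)) (hmem : ∀ x ∈ E.DsX K, F x ∈ E.DsX K)
    (h : ∀ x y, y ∈ φ x ↔ x ∈ E.oneMul K g ∧ F x = y) (x x' : E.DsX K) (hx : x' ∈ φ x) :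
    ∃ e e', e' ∈ φ e ∧ e * x = x ∧ x * e = x := by
  refine ⟨⟨E.one K g, E.one_mem K g hg⟩, ⟨_, hmem _ (E.one_mem K g hg)⟩,
    (h _ _).2 ⟨(mem_oneMul_iff _ _).2 (one_mul_one g), rfl⟩, ?_⟩
  have := (mem_oneMul_iff _ _).1 ((h _ _).1 hx).1
  exact ⟨Subtype.ext this, Subtype.ext ((mul_comm _ _).trans this)⟩

theorem unit_edgeSymm (a : A × Bool) (x x' : E.DsX K)
    (hx : x' ∈ AlgPartialAction.letterSymm (E.edgeSymm K) a x) :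
    ∃ e e', e' ∈ AlgPartialAction.letterSymm (E.edgeSymm K) a e ∧ e * x = x ∧ x * e = x := by
  obtain ⟨f, b⟩ := a
  cases b
  · exact unit_aux _ _ (of_ne_one f) (E.pull K f) (fun _ h => pull_mem f h)
      (mem_edgeSymm_symm f) x x' hx
  · exact unit_aux _ _ (inv_ne_one.2 (of_ne_one f)) (E.push K f) (fun _ h => push_mem f h)
      (mem_edgeSymm f) x x' hx

theorem shift_mem_cyl_iff (f : A) (h : FreeGroup A) (ξ : E.Boundary)
    (hξ : ξ ∈ E.cyl (FreeGroup.of f)) :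
    ξ.shift ∈ E.cyl h ↔ ξ ∈ E.cyl (FreeGroup.of f * h) := by
  have h0 := (mem_cyl_of f ξ).1 hξ
  have hsrc := Boundary.src_shift h0
  have hs := Boundary.src_of_edge_zero h0
  have hcons : ∀ a : E.Path, ξ.shift.HasPrefix a → ∃ c : E.Path, c.edges = f :: a.edges ∧
      c.toGroup = FreeGroup.of f * a.toGroup ∧ ξ.HasPrefix c ∧
      c.edges.getLast c.ne_nil = a.edges.getLast a.ne_nil := by
    intro a ha
    refine ⟨⟨f :: a.edges, by simp, List.IsChain.cons a.chain fun y hy => ?_⟩, rfl,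
      by simp [Path.toGroup], ?_, by simp [List.getLast_cons a.ne_nil]⟩
    · rw [List.head?_eq_some_head a.ne_nil, Option.mem_some_iff] at hy
      rw [← hsrc, Boundary.src_of_edge_zero (HasPrefix.edge_zero ha), hy]
    · rintro (_ | i) hi
      · simpa using h0
      · rw [← Boundary.edge_shift, ha i (by simpa using hi)]; simp
  have huncons : ∀ a : E.Path, ξ.HasPrefix a → a.edges = [f] ∨ ∃ c : E.Path,
      a.edges = f :: c.edges ∧ a.toGroup = FreeGroup.of f * c.toGroup ∧ ξ.shift.HasPrefix c ∧
      a.edges.getLast a.ne_nil = c.edges.getLast c.ne_nil := by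
    intro a ha
    have h1 := (HasPrefix.edge_zero ha).symm.trans h0
    obtain ⟨l, hl, hc⟩ := a
    obtain ⟨g, l, rfl⟩ := List.exists_cons_of_ne_nil hl
    obtain rfl : g = f := by simpa using h1
    by_cases hl' : l = []
    · subst hl'; exact Or.inl rfl
    · refine Or.inr ⟨⟨l, hl', hc.tail⟩, rfl, by simp [Path.toGroup], fun i hi => ?_,
        by simp [List.getLast_cons hl']⟩
      rw [Boundary.edge_shift, ha (i + 1) (by simpa using hi)]; simp
  constructor
  · rintro (rfl | ⟨b, rfl, hb⟩ | ⟨a, rfl, ha⟩ | ⟨a, b, hr, hl, rfl, ha⟩)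
    · simpa using hξ
    · have hbr : E.r f = b.rng := hsrc.symm.trans hb
      by_cases hlast : f = b.edges.getLast b.ne_nil
      · by_cases hd : b.edges.dropLast = []
        · have hbe := List.dropLast_append_getLast b.ne_nil
          rw [hd, List.nil_append, ← hlast] at hbe
          exact Or.inl (by simp [Path.toGroup, ← hbe])
        · have hbe := List.dropLast_append_getLast b.ne_nil
          rw [← hlast] at hbe
          refine Or.inr (Or.inl ⟨⟨b.edges.dropLast, hd, b.chain.dropLast⟩, ?_, ?_⟩)
          · have hpr := congrArg (fun l => (l.map FreeGroup.of).prod) hbe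
            simp only [List.map_append, List.prod_append, List.map_cons, List.map_nil,
              List.prod_singleton] at hpr
            rw [Path.toGroup, Path.toGroup, ← hpr]
            simp
          · have hch := b.chain
            rw [← hbe] at hch
            rw [hs]
            exact ((List.isChain_append.1 hch).2.2 _
              (List.getLast?_eq_some_getLast hd) f (by simp)).symm
      · refine Or.inr (Or.inr (Or.inr ⟨E.edgePath f, b, hbr, hlast, ?_, ?_⟩))
        · rw [toGroup_edgePath]
        · simpa [Boundary.HasPrefix, edgePath] using h0
    · obtain ⟨c, -, hc, hp, -⟩ := hcons a ha
      exact Or.inr (Or.inr (Or.inl ⟨c, hc.symm, hp⟩))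
    · obtain ⟨c, -, hc, hp, hl'⟩ := hcons a ha
      refine Or.inr (Or.inr (Or.inr ⟨c, b, ?_, ?_, by rw [hc, mul_assoc], hp⟩))
      · rw [← hr, Path.rng, Path.rng, hl']
      · rwa [hl']
  · rintro (hk | ⟨b, hk, hb⟩ | ⟨a, hk, ha⟩ | ⟨a, b, hr, hl, hk, ha⟩)
    · obtain rfl : h = (FreeGroup.of f)⁻¹ := eq_inv_of_mul_eq_one_right hk
      exact (mem_cyl_of_inv _ _).2 hsrc
    · obtain rfl := eq_inv_mul_of_mul_eq hk
      refine Or.inr (Or.inl ⟨⟨b.edges ++ [f], by simp, ?_⟩, ?_, ?_⟩)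
      · refine List.isChain_append.2 ⟨b.chain, by simp, fun x hx y hy => ?_⟩
        rw [List.getLast?_eq_some_getLast b.ne_nil, Option.mem_some_iff] at hx
        obtain rfl : f = y := by simpa using hy
        rw [← hx, ← hs, hb]
        rfl
      · simp [Path.toGroup]
      · simpa [Path.rng] using hsrc
    · obtain rfl := eq_inv_mul_of_mul_eq hk
      rcases huncons a ha with h1 | ⟨c, -, hc, hp, -⟩
      · exact Or.inl (by simp [Path.toGroup, h1])
      · exact Or.inr (Or.inr (Or.inl ⟨c, by simp [hc], hp⟩))
    · obtain rfl := eq_inv_mul_of_mul_eq hk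
      rcases huncons a ha with h1 | ⟨c, -, hc, hp, hl'⟩
      · refine Or.inr (Or.inl ⟨b, by simp [Path.toGroup, h1], ?_⟩)
        rw [hsrc, ← hr]
        simp [Path.rng, h1]
      · refine Or.inr (Or.inr (Or.inr ⟨c, b, ?_, ?_, by simp [hc, mul_assoc], hp⟩))
        · rw [← hr, Path.rng, Path.rng, hl']
        · rwa [← hl']

/-- The defining property of `β_f`. -/
theorem edgeSymm_one (f : A) (h : FreeGroup A) (φ ψ : E.DsX K)
    (hφ : (φ : E.Boundary → K) = E.one K (FreeGroup.of f)⁻¹ * E.one K h)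
    (hψ : (ψ : E.Boundary → K) = E.one K (FreeGroup.of f) * E.one K (FreeGroup.of f * h)) :
    E.edgeSymm K f φ = some ψ := by
  refine (mem_edgeSymm f φ ψ).2 ⟨(mem_oneMul_iff _ _).2 ?_, ?_⟩
  · rw [hφ, ← mul_assoc, one_mul_one]
  · rw [hφ, hψ]
    ext ξ
    by_cases hξ : ξ ∈ E.cyl (FreeGroup.of f)
    · have h1 := (mem_cyl_of f ξ).1 hξ
      have h2 : ξ.shift ∈ E.cyl (FreeGroup.of f)⁻¹ := (mem_cyl_of_inv _ _).2 (Boundary.src_shift h1)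
      have h3 := shift_mem_cyl_iff f h ξ hξ
      by_cases h4 : ξ.shift ∈ E.cyl h
      · simp [push, one, hξ, h2, h4, h3.1 h4]
      · simp [push, one, hξ, h2, h4, mt h3.2 h4]
    · simp [push, one, hξ]

variable (E K)

/-- The partial action `β` of the free group on the edges on `D^s(X)`: the semi-saturated partial
action generated by the partial symmetries `β_f`. -/
noncomputable def betaAction : AlgPartialAction (FreeGroup A) K (E.DsX K) :=
  AlgPartialAction.ofGenerators (E.edgeSymm K) isPartialAlgHom_edgeSymm unit_edgeSymm

end DirGraph

/-! For a vertex `x` let `1_x` be the characteristic function of the boundary points with source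
`x`. The isomorphism sends `x` to `1_x δ_1`, `f` to `1_f δ_f` and `f*` to `1_{f⁻¹} δ_{f⁻¹}`.

Homomorphism. Left multiplication by the images of `f` and `f*` acts on coefficients as `β_f` and
its inverse (`skewEdge_mul_delta`, `skewGhost_mul_delta`), so each Leavitt relation becomes an
identity of characteristic functions. That `1_x` lies in `D^s(X)` uses the absence of isolated
vertices and, for an infinite emitter that receives no edge, the adjoined series
(`src_indicator_mem`). The target is associative because its ideals have local units
(`mulHomogeneous_assoc`, `hasLeftLocalUnits_ofGenerators`). The algebras need not be unital, so the
map is built from the universal unital algebra to a unitization (`unitalHom`) and then restricted.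

Surjectivity. The coefficients of `δ_1` are spanned by the `1_x` and the functions of path
cylinders, and the cylinder of a path `a` comes from `a a*`. Semi-saturation reduces any other `δ_g`
to `δ_1` by removing the letters of `g` one at a time (`delta_mem_leavittImage`).

Injectivity. The map respects degrees in the free group, so a kernel element may be taken
homogeneous (`unitalHom_injective`). Such an element is `l z l'*` with `z` in the diagonal, the span
of the monomials `m x m*`, and `l`, `l'` can be stripped off (`exists_eq_lPath_mul_mul`,
`unitalHom_injective_homogeneous`). On the diagonal one inducts on the path length: `f* y f` is
shorter than `y`, so it vanishes, whence `f* y = 0` for every edge `f`. What is left at a vertex is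
treated separately for regular vertices, sinks and infinite emitters; the last two cases use that no
non-zero multiple of a vertex is in the kernel (`unitalHom_injective_diagonal_aux`,
`eq_zero_of_unitalHom_smul_lVertex`). -/

namespace AlgPartialAction

/-! ### Associativity of partial skew group rings with local units. -/

section Associativity

variable {G : Type u} {K : Type v} {R : Type w} [Group G] [CommRing K]
  [NonUnitalRing R] [Module K R] (P : AlgPartialAction G K R)

/-- Every element of an ideal of the partial action has a left unit in that ideal. -/
def HasLeftLocalUnits : Prop := ∀ (g : G) (x : R), x ∈ P.D g → ∃ e ∈ P.D g, e * x = x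

/-- By multiplicativity `x` is the product of the preimages of `u` and `b`, and `act h` of that
product times `c` splits off `u`. It is essential that `u` lies in `D h`. -/
theorem act_symm_mul (h : G) (u b : P.D h) (c : R) (x : P.D h⁻¹)
    (hx : (P.act h x : R) = (u : R) * b) :
    (P.act h ⟨(x : R) * c, P.mul_mem_right _ _ _ x.2⟩ : R) =
      (u : R) * P.act h ⟨((P.act h).symm b : R) * c,
        P.mul_mem_right _ _ _ ((P.act h).symm b).2⟩ := by
  have hx' : (x : R) = ((P.act h).symm u : R) * ((P.act h).symm b : R) := by
    have h1 := P.act_mul h ((P.act h).symm u) ((P.act h).symm b)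
    rw [LinearEquiv.apply_symm_apply, LinearEquiv.apply_symm_apply, ← hx] at h1
    exact congrArg Subtype.val ((P.act h).injective (Subtype.ext h1)).symm
  have h2 := P.act_mul h ((P.act h).symm u) ⟨((P.act h).symm b : R) * c,
    P.mul_mem_right _ _ _ ((P.act h).symm b).2⟩
  rw [LinearEquiv.apply_symm_apply] at h2
  rw [← h2]
  congr 2
  exact Subtype.ext (by simp [hx', mul_assoc])

/-- Coefficients such as those of `δ_{(gh)k}` and `δ_{g(hk)}` have different types; this allows them
to be compared in `R`. -/
theorem delta_congr {g h : G} (hgh : g = h) (x : P.D g) (y : P.D h) (hxy : (x : R) = y) :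
    P.delta g x = P.delta h y := by
  subst hgh
  rw [Subtype.ext hxy]

variable {P} in
/-- A property of the elements of the partial skew group ring holds if it holds for homogeneous
elements and is additive. -/
theorem SkewGroupRing.induction {p : P.SkewGroupRing → Prop} (zero : p 0)
    (delta : ∀ g x, p (P.delta g x)) (add : ∀ x y, p x → p y → p (x + y))
    (x : P.SkewGroupRing) : p x := by
  classical
  exact DirectSum.induction_on (β := fun g => P.D g) x zero delta add

theorem symm_one (r : P.D 1) : ((P.act 1).symm r : R) = r := by
  rw [← P.act_one, LinearEquiv.apply_symm_apply]

open Classical in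
/-- The coefficient of `δ_g`. -/
noncomputable def coeff (g : G) : P.SkewGroupRing →ₗ[K] P.D g :=
  DirectSum.component K G (fun g => P.D g) g

theorem coeff_delta_self (g : G) (x : P.D g) : P.coeff g (P.delta g x) = x := by
  classical
  exact DirectSum.component.lof_self (R := K) (ι := G) (M := fun g => P.D g) g x

theorem coeff_delta_ne {g h : G} (hgh : g ≠ h) (x : P.D h) : P.coeff g (P.delta h x) = 0 := by
  classical
  exact (DirectSum.component.of (R := K) (M := fun g => P.D g) g h x).trans (dif_neg hgh.symm)

variable [SMulCommClass K R R] [IsScalarTower K R R]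

theorem coe_mulHomogeneous (g h : G) (r : P.D g) (r' : P.D h) :
    (P.mulHomogeneous g h r r' : R) = P.act g ⟨((P.act g).symm r : R) * (r' : R),
      P.mul_mem_right _ _ _ ((P.act g).symm r).2⟩ := rfl

/-- With `a' = act g⁻¹ a` and `b' = act h⁻¹ b`, both sides are `act g` applied to the two sides of
`act h (act h⁻¹ (a' b) c) = a' act h (b' c)`. This identity is multiplicativity of `act h` if `a'`
lies in `D h`; in general a local unit of `b` moves `a'` there. -/
theorem mulHomogeneous_assoc (hP : P.HasLeftLocalUnits) (g h k : G) (a : P.D g) (b : P.D h)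
    (c : P.D k) : (P.mulHomogeneous (g * h) k (P.mulHomogeneous g h a b) c : R) =
      P.mulHomogeneous g (h * k) a (P.mulHomogeneous h k b c) := by
  simp only [coe_mulHomogeneous]
  set a' := (P.act g).symm a with ha'
  set b' := (P.act h).symm b with hb'
  -- The factor `a'` need not lie in `D h`, but `a' e` does, and `a' e b = a' b`.
  obtain ⟨e, he, heb⟩ := hP h b b.2
  set w := (P.act h).symm ⟨(a' : R) * b, P.mul_mem_left _ _ _ b.2⟩ with hw
  have haw : (P.act h w : R) = (a' : R) * b := by simp [hw]
  -- Since `a' b` lies in both `D h` and `D g⁻¹`, its image under `act h⁻¹` lies in `D (h⁻¹ g⁻¹)`.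
  have hwmem : (w : R) ∈ P.D (g * h)⁻¹ := by
    have h1 : (w : R) ∈ (P.D h⁻¹ : Set R) ∩ (P.D (h⁻¹ * g⁻¹) : Set R) := by
      rw [← P.image_inter]
      have hm : (a' : R) * b ∈ P.D h⁻¹⁻¹ := by
        rw [inv_inv]; exact P.mul_mem_left _ _ _ b.2
      exact ⟨⟨_, hm⟩, P.mul_mem_right _ _ _ a'.2, P.act_inv h _ _ hm⟩
    rw [mul_inv_rev]
    exact h1.2
  have hsymm : ((P.act (g * h)).symm (P.mulHomogeneous g h a b) : R) = w := by
    have h1 : P.mulHomogeneous g h a b = P.act (g * h) ⟨w, hwmem⟩ := by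
      refine Subtype.ext ?_
      rw [← P.act_act g h w w.2 hwmem (by
        rw [Subtype.coe_eta, haw]; exact P.mul_mem_right _ _ _ a'.2), coe_mulHomogeneous]
      congr 2
      exact Subtype.ext haw.symm
    rw [h1, LinearEquiv.symm_apply_apply]
  have key : (P.act h ⟨(w : R) * c, P.mul_mem_right _ _ _ w.2⟩ : R) =
      (a' : R) * P.act h ⟨(b' : R) * c, P.mul_mem_right _ _ _ b'.2⟩ := by
    -- The local unit is first inserted next to `a'`, then absorbed again by `act h (b' c)`.
    rw [P.act_symm_mul h ⟨(a' : R) * e, P.mul_mem_left _ _ _ he⟩ b c w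
      (by rw [haw]; simp [mul_assoc, heb]), mul_assoc]
    rw [← P.act_symm_mul h ⟨e, he⟩ b c b' (by simp [hb', heb])]
  have hfin := P.act_act g h ((w : R) * c) (P.mul_mem_right _ _ _ w.2)
    (P.mul_mem_right _ _ _ hwmem) (by rw [key]; exact P.mul_mem_right _ _ _ a'.2)
  refine Eq.trans ?_ (hfin.symm.trans ?_)
  · congr 2
    exact Subtype.ext (congrArg (· * (c : R)) hsymm)
  · congr 2
    exact Subtype.ext key

theorem skew_mul_assoc (hP : P.HasLeftLocalUnits) (x y z : P.SkewGroupRing) :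
    x * y * z = x * (y * z) := by
  induction x using SkewGroupRing.induction with
  | zero => simp
  | add x x' hx hx' => rw [add_mul, add_mul, add_mul, hx, hx']
  | delta g a =>
    induction y using SkewGroupRing.induction with
    | zero => simp
    | add y y' hy hy' => rw [mul_add, add_mul, add_mul, mul_add, hy, hy']
    | delta h b =>
      induction z using SkewGroupRing.induction with
      | zero => simp
      | add z z' hz hz' => rw [mul_add, mul_add, mul_add, hz, hz']
      | delta k c =>
        simp only [delta_mul_delta]
        exact P.delta_congr (mul_assoc _ _ _) _ _ (P.mulHomogeneous_assoc hP g h k a b c)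

instance : IsScalarTower K P.SkewGroupRing P.SkewGroupRing :=
  ⟨fun k x y => LinearMap.map_smul₂ P.skewMul k x y⟩

instance : SMulCommClass K P.SkewGroupRing P.SkewGroupRing :=
  ⟨fun k x y => ((P.skewMul x).map_smul k y).symm⟩

theorem delta_one_mul_delta (g : G) (r : P.D 1) (r' : P.D g) :
    P.delta 1 r * P.delta g r' = P.delta g ⟨(r : R) * r', P.mul_mem_left _ _ _ r'.2⟩ := by
  rw [delta_mul_delta]
  refine P.delta_congr (one_mul g) _ _ ?_
  rw [coe_mulHomogeneous, P.act_one]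
  simp [symm_one]

end Associativity

/-! ### Local units for partial actions generated by partial symmetries. -/

section LocalUnits

variable {A : Type u} {K : Type v} {R : Type w} [CommRing K] [NonUnitalRing R] [Module K R]

/-- Induction on the word: if `e` is a unit for `z` in the range of the tail and `u` is one in the
domain of the first letter, then `e u` is a unit for `z` in both ideals, and the letter carries it
to a unit for the image of `z`. -/
theorem exists_unit_wordSymm (β : A → R ≃. R)
    (hβ : ∀ x, IsPartialAlgHom K (letterSymm β x))
    (hu : ∀ a x x', x' ∈ letterSymm β a x →
      ∃ e e', e' ∈ letterSymm β a e ∧ e * x = x ∧ x * e = x)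
    (hR : ∀ x : R, ∃ e, e * x = x)
    (l : List (A × Bool)) (x y : R) (hy : y ∈ wordSymm β l x) :
    ∃ d e, e ∈ wordSymm β l d ∧ e * y = y := by
  induction l generalizing x y with
  | nil =>
    obtain ⟨e, he⟩ := hR y
    exact ⟨e, e, rfl, he⟩
  | cons a l ih =>
    obtain ⟨z, hz, hzy⟩ := (PEquiv.mem_trans _ _ _ _).1 hy
    obtain ⟨d, e, hde, hez⟩ := ih x z hz
    obtain ⟨u, u', hu', huz, -⟩ := hu a z y hzy
    obtain ⟨t, ht⟩ := (hβ a).ideal_left e u u' hu'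
    -- The range of a word is the domain of the inverse word, which is an ideal; hence `e * u` is in
    -- the range of `l`.
    obtain ⟨c, hc⟩ := (isPartialAlgHom_wordSymm β hβ hu (FreeGroup.invRev l)).ideal_right u e d
      (by rwa [wordSymm_invRev, PEquiv.mem_iff_mem])
    rw [wordSymm_invRev, PEquiv.mem_iff_mem] at hc
    refine ⟨c, t, (PEquiv.mem_trans _ _ _ _).2 ⟨_, hc, ht⟩, ?_⟩
    have h1 := (hβ a).mul _ _ _ _ ht hzy
    rw [mul_assoc, huz, hez] at h1
    exact Option.some_injective _ ((Option.mem_def.1 h1).symm.trans (Option.mem_def.1 hzy))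

theorem hasLeftLocalUnits_ofGenerators (β : A → R ≃. R)
    (hβ : ∀ x, IsPartialAlgHom K (letterSymm β x))
    (hu : ∀ a x x', x' ∈ letterSymm β a x →
      ∃ e e', e' ∈ letterSymm β a e ∧ e * x = x ∧ x * e = x)
    (hR : ∀ x : R, ∃ e, e * x = x) : (ofGenerators β hβ hu).HasLeftLocalUnits := by
  rintro g y ⟨x, hx⟩
  obtain ⟨d, e, he, hy⟩ := exists_unit_wordSymm β hβ hu hR _ x y hx
  exact ⟨e, ⟨d, he⟩, hy⟩

/-- Links the total map `act g`, whose values are extracted from options, to the partial symmetries,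
so that `mem_edgeSymm` becomes applicable. -/
theorem act_ofGenerators_mem (β : A → R ≃. R)
    (hβ : ∀ x, IsPartialAlgHom K (letterSymm β x))
    (hu : ∀ a x x', x' ∈ letterSymm β a x →
      ∃ e e', e' ∈ letterSymm β a e ∧ e * x = x ∧ x * e = x) (g : FreeGroup A)
    (x : (ofGenerators β hβ hu).D g⁻¹) :
    ((ofGenerators β hβ hu).act g x : R) ∈ freeSymm β g (x : R) :=
  Option.get_mem _

end LocalUnits

end AlgPartialAction

/-! ### The Leavitt relations in the partial skew group ring. -/

namespace DirGraph

variable {V : Type u} {A : Type v} {E : DirGraph V A} {K : Type w} [Field K]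

/-- By `span_generators` only the characteristic functions of basic sets have to be considered,
instead of all `1_g` and the series. -/
theorem DsX_induction {p : (E.Boundary → K) → Prop}
    (basic : ∀ S, E.IsBasic S → p (S.indicator 1)) (zero : p 0)
    (add : ∀ φ ψ, φ ∈ E.DsX K → ψ ∈ E.DsX K → p φ → p ψ → p (φ + ψ))
    (smul : ∀ (k : K) φ, φ ∈ E.DsX K → p φ → p (k • φ)) {φ : E.Boundary → K}
    (hφ : φ ∈ E.DsX K) : p φ := by
  have hmem : ∀ φ, φ ∈ E.DsX K ↔
      φ ∈ Submodule.span K {φ : E.Boundary → K | ∃ S, E.IsBasic S ∧ φ = S.indicator 1} := by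
    intro φ
    rw [← span_generators]
    rfl
  rw [hmem] at hφ
  induction hφ using Submodule.span_induction with
  | mem φ h =>
    obtain ⟨S, hS, rfl⟩ := h
    exact basic S hS
  | zero => exact zero
  | add φ ψ hφ hψ h1 h2 => exact add φ ψ ((hmem _).2 hφ) ((hmem _).2 hψ) h1 h2
  | smul k φ hφ h => exact smul k φ ((hmem _).2 hφ) h

theorem indicator_mul_self (S : Set E.Boundary) :
    (S.indicator 1 : E.Boundary → K) * S.indicator 1 = S.indicator 1 := by
  rw [← Set.inter_indicator_one, Set.inter_self]

/-- A characteristic function is its own unit. If `d` and `e` are units for `φ` and `ψ`, then `d + e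
- d e` is one for both, since the algebra is commutative. -/
theorem DsX_exists_mul_eq_self (x : E.DsX K) : ∃ e : E.DsX K, e * x = x := by
  suffices h : ∃ e ∈ E.DsX K, e * (x : E.Boundary → K) = x by
    obtain ⟨e, he, hx⟩ := h
    exact ⟨⟨e, he⟩, Subtype.ext hx⟩
  refine DsX_induction (p := fun φ => ∃ e ∈ E.DsX K, e * φ = φ)
    (fun S hS => ⟨_, E.indicator_mem_DsX K hS, indicator_mul_self S⟩)
    ⟨0, zero_mem _, by simp⟩ ?_ ?_ x.2
  · rintro φ ψ - - ⟨d, hd, h1⟩ ⟨e, he, h2⟩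
    refine ⟨d + e - d * e, sub_mem (add_mem hd he) (mul_mem hd he), ?_⟩
    calc (d + e - d * e) * (φ + ψ)
        = d * φ + e * φ - e * (d * φ) + (d * ψ + e * ψ - d * (e * ψ)) := by ring
      _ = φ + ψ := by rw [h1, h2]; ring
  · rintro k φ - ⟨e, he, h⟩
    exact ⟨e, he, by rw [mul_smul_comm, h]⟩

theorem one_of (f : A) :
    E.one K (FreeGroup.of f) = {ξ : E.Boundary | ξ.edge 0 = some f}.indicator 1 := by
  rw [one]
  congr 1
  ext ξ
  exact mem_cyl_of f ξ

theorem one_of_inv (f : A) :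
    E.one K (FreeGroup.of f)⁻¹ = {ξ : E.Boundary | ξ.src = E.r f}.indicator 1 := by
  rw [one]
  congr 1
  ext ξ
  exact mem_cyl_of_inv f ξ

/-- For a finite emitter the emitter series is a finite sum; this becomes the relation `x = ∑ f f*`
in the skew group ring. -/
theorem src_indicator_eq_sum (x : V) (hfin : {f | E.s f = x}.Finite)
    (hne : {f | E.s f = x}.Nonempty) :
    ({ξ : E.Boundary | ξ.src = x}.indicator 1 : E.Boundary → K) =
      ∑ f ∈ hfin.toFinset, E.one K (FreeGroup.of f) := by
  obtain ⟨f, hf⟩ := hne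
  rw [← emitterSeries_eq K fun hs => hs f hf]
  ext ξ
  rw [Finset.sum_apply, emitterSeries]
  exact (finsum_set_coe_eq_finsum_mem (f := fun f => E.one K (FreeGroup.of f) ξ)
    {f | E.s f = x}).trans (finsum_mem_eq_finite_toFinset_sum _ hfin)

/-- If `x` receives an edge `f`, this is `1_{f⁻¹}`; if `x` is an infinite emitter, it is the
adjoined series. Otherwise `x` emits finitely many edges, and at least one because it is not
isolated, so it is a finite sum of the `1_f`. -/
theorem src_indicator_mem (x : V) (hx : ¬ E.IsIsolated x) :
    ({ξ : E.Boundary | ξ.src = x}.indicator 1 : E.Boundary → K) ∈ E.DsX K := by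
  by_cases hr : ∃ f, E.r f = x
  · exact E.indicator_mem_DsX K (.src x (Or.inl hr))
  by_cases hi : E.IsInfiniteEmitter x
  · exact E.indicator_mem_DsX K (.src x (Or.inr hi))
  have hne : {f | E.s f = x}.Nonempty := by
    by_contra h
    exact hx ⟨fun f hf => h ⟨f, hf⟩, fun f hf => hr ⟨f, hf⟩⟩
  rw [src_indicator_eq_sum x (Set.not_infinite.1 hi) hne]
  exact sum_mem fun f _ => E.one_mem K _ (of_ne_one f)

theorem push_one_inv (f : A) :
    E.push K f (E.one K (FreeGroup.of f)⁻¹) = E.one K (FreeGroup.of f) := by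
  rw [one_of_inv, push_indicator, one_of]
  congr 1
  ext ξ
  exact ⟨fun h => h.1, fun h => ⟨h, Boundary.src_shift h⟩⟩

theorem pull_one (f : A) :
    E.pull K f (E.one K (FreeGroup.of f)) = E.one K (FreeGroup.of f)⁻¹ := by
  rw [one_of_inv, one_of, pull_indicator]
  congr 1
  ext ξ
  exact ⟨fun h => h.1, fun h => ⟨h, Boundary.edge_cons_zero _ _ _⟩⟩

theorem pull_one_of_ne {f g : A} (h : f ≠ g) :
    E.pull K f (E.one K (FreeGroup.of g)) = 0 := by
  rw [one_of, pull_indicator]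
  refine Set.indicator_eq_zero.2 (Set.disjoint_right.2 ?_)
  rintro ξ ⟨h1, h2⟩
  have h3 : some f = some g := (Boundary.edge_cons_zero _ _ _).symm.trans h2
  exact absurd (Option.some_injective _ h3) h

theorem pull_src (f : A) :
    E.pull K f ({ξ : E.Boundary | ξ.src = E.s f}.indicator 1) = E.one K (FreeGroup.of f)⁻¹ := by
  rw [one_of_inv, pull_indicator]
  congr 1
  ext ξ
  exact ⟨fun h => h.1, fun h => ⟨h, Boundary.src_cons _ _ _⟩⟩

theorem hasLeftLocalUnits_betaAction : (E.betaAction K).HasLeftLocalUnits :=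
  AlgPartialAction.hasLeftLocalUnits_ofGenerators _ _ _ DsX_exists_mul_eq_self

noncomputable instance : NonUnitalRing (E.betaAction K).SkewGroupRing where
  mul_assoc := (E.betaAction K).skew_mul_assoc hasLeftLocalUnits_betaAction

theorem edge_mem_D (f : A) :
    (⟨E.one K (FreeGroup.of f), E.one_mem K _ (of_ne_one f)⟩ : E.DsX K) ∈
      (E.betaAction K).D (FreeGroup.of f) := by
  refine ⟨⟨E.one K (FreeGroup.of f)⁻¹, E.one_mem K _ (inv_ne_one.2 (of_ne_one f))⟩, ?_⟩
  rw [AlgPartialAction.freeSymm_of, mem_edgeSymm, mem_oneMul_iff]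
  exact ⟨one_mul_one _, push_one_inv f⟩

theorem ghost_mem_D (f : A) :
    (⟨E.one K (FreeGroup.of f)⁻¹, E.one_mem K _ (inv_ne_one.2 (of_ne_one f))⟩ : E.DsX K) ∈
      (E.betaAction K).D (FreeGroup.of f)⁻¹ := by
  refine ⟨⟨E.one K (FreeGroup.of f), E.one_mem K _ (of_ne_one f)⟩, ?_⟩
  rw [AlgPartialAction.freeSymm_inv, AlgPartialAction.freeSymm_of, mem_edgeSymm_symm,
    mem_oneMul_iff]
  exact ⟨one_mul_one _, pull_one f⟩

theorem mem_D_one (x : E.DsX K) : x ∈ (E.betaAction K).D 1 := by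
  rw [(E.betaAction K).D_one]; trivial

variable (K) in
/-- The element `1_f δ_f`. -/
noncomputable def skewEdge (f : A) : (E.betaAction K).SkewGroupRing :=
  (E.betaAction K).delta (FreeGroup.of f) ⟨_, edge_mem_D f⟩

variable (K) in
/-- The element `1_{f⁻¹} δ_{f⁻¹}`. -/
noncomputable def skewGhost (f : A) : (E.betaAction K).SkewGroupRing :=
  (E.betaAction K).delta (FreeGroup.of f)⁻¹ ⟨_, ghost_mem_D f⟩

variable (K) in
/-- The element `1_x δ_1`, where `1_x` is the characteristic function of the set of all elements
with source `x`. -/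
noncomputable def skewVertex (x : V) (hx : ¬ E.IsIsolated x) : (E.betaAction K).SkewGroupRing :=
  (E.betaAction K).delta 1 ⟨⟨_, src_indicator_mem x hx⟩, mem_D_one _⟩

/-- The preimage `u` of `1_f` satisfies `push u = 1_f`, so the coefficient of the product is `push
(u r) = 1_f push r = push r`. As `push` is defined on all functions, `r` need not lie in the domain
of `β_f`. -/
theorem skewEdge_mul_delta (f : A) (g h : FreeGroup A) (r : (E.betaAction K).D g)
    (y : (E.betaAction K).D h) (hh : FreeGroup.of f * g = h)
    (hy : E.push K f ((r : E.DsX K) : E.Boundary → K) = (y : E.DsX K)) :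
    E.skewEdge K f * (E.betaAction K).delta g r = (E.betaAction K).delta h y := by
  rw [skewEdge, AlgPartialAction.delta_mul_delta]
  refine AlgPartialAction.delta_congr _ hh _ _ ?_
  rw [AlgPartialAction.coe_mulHomogeneous]
  set u := ((E.betaAction K).act (FreeGroup.of f)).symm ⟨_, edge_mem_D f⟩ with hu
  have h1 := AlgPartialAction.act_ofGenerators_mem (E.edgeSymm K) isPartialAlgHom_edgeSymm
    unit_edgeSymm (FreeGroup.of f) u
  have h2 := AlgPartialAction.act_ofGenerators_mem (E.edgeSymm K) isPartialAlgHom_edgeSymm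
    unit_edgeSymm (FreeGroup.of f) ⟨(u : E.DsX K) * (r : E.DsX K),
      (E.betaAction K).mul_mem_right _ _ _ u.2⟩
  rw [AlgPartialAction.freeSymm_of, mem_edgeSymm] at h1 h2
  have h3 : (E.betaAction K).act (FreeGroup.of f) u = ⟨_, edge_mem_D f⟩ := by
    rw [hu, LinearEquiv.apply_symm_apply]
  refine Subtype.ext (h2.2.symm.trans ?_)
  have h4 : E.push K f ((u : E.DsX K) : E.Boundary → K) = E.one K (FreeGroup.of f) :=
    h1.2.trans (congrArg (fun z : (E.betaAction K).D _ => ((z : E.DsX K) : E.Boundary → K)) h3)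
  refine (push_mul f _ _).trans ?_
  rw [h4, one_mul_push, hy]

/-- The same computation with `pull`, for the inverse of `β_f`. -/
theorem skewGhost_mul_delta (f : A) (g h : FreeGroup A) (r : (E.betaAction K).D g)
    (y : (E.betaAction K).D h) (hh : (FreeGroup.of f)⁻¹ * g = h)
    (hy : E.pull K f ((r : E.DsX K) : E.Boundary → K) = (y : E.DsX K)) :
    E.skewGhost K f * (E.betaAction K).delta g r = (E.betaAction K).delta h y := by
  rw [skewGhost, AlgPartialAction.delta_mul_delta]
  refine AlgPartialAction.delta_congr _ hh _ _ ?_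
  rw [AlgPartialAction.coe_mulHomogeneous]
  set u := ((E.betaAction K).act (FreeGroup.of f)⁻¹).symm ⟨_, ghost_mem_D f⟩ with hu
  have h1 := AlgPartialAction.act_ofGenerators_mem (E.edgeSymm K) isPartialAlgHom_edgeSymm
    unit_edgeSymm (FreeGroup.of f)⁻¹ u
  have h2 := AlgPartialAction.act_ofGenerators_mem (E.edgeSymm K) isPartialAlgHom_edgeSymm
    unit_edgeSymm (FreeGroup.of f)⁻¹ ⟨(u : E.DsX K) * (r : E.DsX K),
      (E.betaAction K).mul_mem_right _ _ _ u.2⟩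
  rw [AlgPartialAction.freeSymm_inv, AlgPartialAction.freeSymm_of, mem_edgeSymm_symm] at h1 h2
  have h3 : (E.betaAction K).act (FreeGroup.of f)⁻¹ u = ⟨_, ghost_mem_D f⟩ := by
    rw [hu, LinearEquiv.apply_symm_apply]
  refine Subtype.ext (h2.2.symm.trans ?_)
  have h4 : E.pull K f ((u : E.DsX K) : E.Boundary → K) = E.one K (FreeGroup.of f)⁻¹ :=
    h1.2.trans (congrArg (fun z : (E.betaAction K).D _ => ((z : E.DsX K) : E.Boundary → K)) h3)
  refine (pull_mul f _ _).trans ?_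
  rw [h4, one_mul_pull, hy]

theorem delta_one_mul (g : FreeGroup A) (d : (E.betaAction K).D 1) (r y : (E.betaAction K).D g)
    (hy : ((d : E.DsX K) : E.Boundary → K) * ((r : E.DsX K) : E.Boundary → K) = (y : E.DsX K)) :
    (E.betaAction K).delta 1 d * (E.betaAction K).delta g r = (E.betaAction K).delta g y := by
  rw [AlgPartialAction.delta_one_mul_delta]
  exact AlgPartialAction.delta_congr _ rfl _ _ (Subtype.ext hy)

theorem skewVertex_mul_self (x : V) (hx : ¬ E.IsIsolated x) :
    E.skewVertex K x hx * E.skewVertex K x hx = E.skewVertex K x hx :=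
  delta_one_mul _ _ _ _ (indicator_mul_self _)

theorem delta_eq_zero {g : FreeGroup A} {x : (E.betaAction K).D g}
    (h : ((x : E.DsX K) : E.Boundary → K) = 0) : (E.betaAction K).delta g x = 0 := by
  have : x = 0 := Subtype.ext (Subtype.ext h)
  rw [this, map_zero]

theorem skewVertex_mul_of_ne {x y : V} (hx : ¬ E.IsIsolated x) (hy : ¬ E.IsIsolated y)
    (h : x ≠ y) : E.skewVertex K x hx * E.skewVertex K y hy = 0 := by
  rw [skewVertex, skewVertex, AlgPartialAction.delta_one_mul_delta]
  refine delta_eq_zero ?_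
  change Set.indicator _ _ * Set.indicator _ _ = _
  rw [← Set.inter_indicator_one]
  refine Set.indicator_eq_zero.2 (Set.disjoint_right.2 ?_)
  rintro ξ ⟨h1, h2⟩
  exact absurd (h1.symm.trans h2) h

theorem skewVertex_mul_skewEdge (f : A) (h : ¬ E.IsIsolated (E.s f)) :
    E.skewVertex K (E.s f) h * E.skewEdge K f = E.skewEdge K f := by
  refine delta_one_mul _ _ _ _ ?_
  change Set.indicator _ _ * E.one K _ = E.one K _
  rw [one_of, ← Set.inter_indicator_one]
  congr 1
  exact Set.inter_eq_right.2 fun ξ hξ => Boundary.src_of_edge_zero hξ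

theorem skewEdge_mul_skewVertex (f : A) (h : ¬ E.IsIsolated (E.r f)) :
    E.skewEdge K f * E.skewVertex K (E.r f) h = E.skewEdge K f :=
  skewEdge_mul_delta f _ _ _ _ (mul_one _) (by
    refine Eq.trans ?_ (push_one_inv f)
    rw [one_of_inv])

theorem skewVertex_mul_skewGhost (f : A) (h : ¬ E.IsIsolated (E.r f)) :
    E.skewVertex K (E.r f) h * E.skewGhost K f = E.skewGhost K f := by
  refine delta_one_mul _ _ _ _ ?_
  change Set.indicator _ _ * E.one K _ = E.one K _
  rw [one_of_inv, indicator_mul_self]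

theorem skewGhost_mul_skewVertex (f : A) (h : ¬ E.IsIsolated (E.s f)) :
    E.skewGhost K f * E.skewVertex K (E.s f) h = E.skewGhost K f :=
  skewGhost_mul_delta f _ _ _ _ (mul_one _) (pull_src f)

theorem skewGhost_mul_skewEdge_self (f : A) (h : ¬ E.IsIsolated (E.r f)) :
    E.skewGhost K f * E.skewEdge K f = E.skewVertex K (E.r f) h :=
  skewGhost_mul_delta f _ _ _ _ (inv_mul_cancel _) (by
    refine (pull_one f).trans ?_
    rw [one_of_inv])

theorem skewGhost_mul_skewEdge_of_ne {f g : A} (h : f ≠ g) :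
    E.skewGhost K f * E.skewEdge K g = 0 :=
  (skewGhost_mul_delta f _ _ _ 0 rfl (pull_one_of_ne h)).trans (map_zero _)

theorem skewEdge_mul_skewGhost (f : A) : E.skewEdge K f * E.skewGhost K f =
    (E.betaAction K).delta 1 ⟨⟨E.one K (FreeGroup.of f), E.one_mem K _ (of_ne_one f)⟩,
      mem_D_one _⟩ :=
  skewEdge_mul_delta f _ _ _ _ (mul_inv_cancel _) (push_one_inv f)

theorem skewVertex_eq_sum (x : V) (hx : ¬ E.IsIsolated x) (hfin : {f | E.s f = x}.Finite)
    (hne : {f | E.s f = x}.Nonempty) :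
    E.skewVertex K x hx = ∑ f ∈ hfin.toFinset, E.skewEdge K f * E.skewGhost K f := by
  simp only [skewEdge_mul_skewGhost]
  rw [← map_sum, skewVertex]
  refine AlgPartialAction.delta_congr _ rfl _ _ (Subtype.ext ?_)
  refine (src_indicator_eq_sum x hfin hne).trans ?_
  simp only [AddSubmonoidClass.coe_finsetSum]

/-- The image of a generator of the Leavitt path algebra in the partial skew group ring. -/
noncomputable def skewGen (K : Type w) [Field K] (hE : ∀ x : V, ¬ E.IsIsolated x) :
    LeavittGen V A → (E.betaAction K).SkewGroupRing
  | .vertex x => E.skewVertex K x (hE x)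
  | .edge f => E.skewEdge K f
  | .ghost f => E.skewGhost K f

/-- The homomorphism from the universal unital algebra on the Leavitt relations to the unitization
of the partial skew group ring. -/
noncomputable def unitalHom (K : Type w) [Field K] (hE : ∀ x : V, ¬ E.IsIsolated x) :
    RingQuot (E.LeavittRel K) →ₐ[K] Unitization K (E.betaAction K).SkewGroupRing :=
  RingQuot.liftAlgHom K ⟨FreeAlgebra.lift K fun x =>
    (Unitization.inr (skewGen K hE x) : Unitization K (E.betaAction K).SkewGroupRing), by
    intro a b hab
    induction hab with
    | vertex_idem x =>
      simp only [freeGen, map_mul, FreeAlgebra.lift_ι_apply, ← Unitization.inr_mul, skewGen,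
        skewVertex_mul_self]
    | vertex_orth x y h =>
      simp only [freeGen, map_mul, map_zero, FreeAlgebra.lift_ι_apply, ← Unitization.inr_mul,
        skewGen, skewVertex_mul_of_ne _ _ h, Unitization.inr_zero]
    | source_edge f =>
      simp only [freeGen, map_mul, FreeAlgebra.lift_ι_apply, ← Unitization.inr_mul, skewGen,
        skewVertex_mul_skewEdge]
    | edge_range f =>
      simp only [freeGen, map_mul, FreeAlgebra.lift_ι_apply, ← Unitization.inr_mul, skewGen,
        skewEdge_mul_skewVertex]
    | range_ghost f =>
      simp only [freeGen, map_mul, FreeAlgebra.lift_ι_apply, ← Unitization.inr_mul, skewGen,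
        skewVertex_mul_skewGhost]
    | ghost_source f =>
      simp only [freeGen, map_mul, FreeAlgebra.lift_ι_apply, ← Unitization.inr_mul, skewGen,
        skewGhost_mul_skewVertex]
    | ghost_edge_self f =>
      simp only [freeGen, map_mul, FreeAlgebra.lift_ι_apply, ← Unitization.inr_mul, skewGen,
        skewGhost_mul_skewEdge_self f (hE _)]
    | ghost_edge_ne f g h =>
      simp only [freeGen, map_mul, map_zero, FreeAlgebra.lift_ι_apply, ← Unitization.inr_mul,
        skewGen, skewGhost_mul_skewEdge_of_ne h, Unitization.inr_zero]
    | vertex_sum x hfin hne =>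
      simp only [freeGen, map_mul, map_sum, FreeAlgebra.lift_ι_apply, ← Unitization.inr_mul,
        skewGen, skewVertex_eq_sum x (hE x) hfin hne]
      exact map_sum (Unitization.inrNonUnitalAlgHom K (E.betaAction K).SkewGroupRing) _ _⟩

theorem unitalHom_leavittGen (hE : ∀ x : V, ¬ E.IsIsolated x) (x : LeavittGen V A) :
    unitalHom K hE (E.leavittGen K x) = Unitization.inr (skewGen K hE x) := by
  rw [unitalHom, leavittGen, RingQuot.liftAlgHom_mkAlgHom_apply, freeGen,
    FreeAlgebra.lift_ι_apply]

end DirGraph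

/-! ### Monomials in the Leavitt path algebra. -/

namespace DirGraph

variable {V : Type u} {A : Type v} (E : DirGraph V A) (K : Type w) [Field K]

/-- The vertex `x` as an element of the universal unital algebra on the Leavitt relations. -/
noncomputable def lVertex (x : V) : RingQuot (E.LeavittRel K) := E.leavittGen K (.vertex x)

/-- The edge `f` as an element of the universal unital algebra on the Leavitt relations. -/
noncomputable def lEdge (f : A) : RingQuot (E.LeavittRel K) := E.leavittGen K (.edge f)

/-- The ghost edge `f*` as an element of the universal unital algebra on the Leavitt relations. -/
noncomputable def lGhost (f : A) : RingQuot (E.LeavittRel K) := E.leavittGen K (.ghost f)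

/-- The product of the edges in a list. -/
noncomputable def lPath (l : List A) : RingQuot (E.LeavittRel K) := (l.map (E.lEdge K)).prod

/-- The product of the ghost edges in a list, in reverse order. -/
noncomputable def lGhostPath (l : List A) : RingQuot (E.LeavittRel K) :=
  (l.reverse.map (E.lGhost K)).prod

/-- The monomial `l x l'*`. -/
noncomputable def lMono (l : List A) (x : V) (l' : List A) : RingQuot (E.LeavittRel K) :=
  E.lPath K l * E.lVertex K x * E.lGhostPath K l'

variable {E K}

theorem lVertex_mul_self (x : V) : E.lVertex K x * E.lVertex K x = E.lVertex K x := by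
  simpa only [map_mul, lVertex, lEdge, lGhost, leavittGen] using
    RingQuot.mkAlgHom_rel K (LeavittRel.vertex_idem (E := E) (K := K) x)

theorem lVertex_mul_of_ne {x y : V} (h : x ≠ y) : E.lVertex K x * E.lVertex K y = 0 := by
  simpa only [map_mul, map_zero, lVertex, lEdge, lGhost, leavittGen] using
    RingQuot.mkAlgHom_rel K (LeavittRel.vertex_orth (E := E) (K := K) x y h)

theorem lVertex_mul_lEdge (f : A) : E.lVertex K (E.s f) * E.lEdge K f = E.lEdge K f := by
  simpa only [map_mul, lVertex, lEdge, lGhost, leavittGen] using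
    RingQuot.mkAlgHom_rel K (LeavittRel.source_edge (E := E) (K := K) f)

theorem lEdge_mul_lVertex (f : A) : E.lEdge K f * E.lVertex K (E.r f) = E.lEdge K f := by
  simpa only [map_mul, lVertex, lEdge, lGhost, leavittGen] using
    RingQuot.mkAlgHom_rel K (LeavittRel.edge_range (E := E) (K := K) f)

theorem lVertex_mul_lGhost (f : A) : E.lVertex K (E.r f) * E.lGhost K f = E.lGhost K f := by
  simpa only [map_mul, lVertex, lEdge, lGhost, leavittGen] using
    RingQuot.mkAlgHom_rel K (LeavittRel.range_ghost (E := E) (K := K) f)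

theorem lGhost_mul_lVertex (f : A) : E.lGhost K f * E.lVertex K (E.s f) = E.lGhost K f := by
  simpa only [map_mul, lVertex, lEdge, lGhost, leavittGen] using
    RingQuot.mkAlgHom_rel K (LeavittRel.ghost_source (E := E) (K := K) f)

theorem lGhost_mul_lEdge_self (f : A) :
    E.lGhost K f * E.lEdge K f = E.lVertex K (E.r f) := by
  simpa only [map_mul, lVertex, lEdge, lGhost, leavittGen] using
    RingQuot.mkAlgHom_rel K (LeavittRel.ghost_edge_self (E := E) (K := K) f)

theorem lGhost_mul_lEdge_of_ne {f g : A} (h : f ≠ g) : E.lGhost K f * E.lEdge K g = 0 := by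
  simpa only [map_mul, map_zero, lVertex, lEdge, lGhost, leavittGen] using
    RingQuot.mkAlgHom_rel K (LeavittRel.ghost_edge_ne (E := E) (K := K) f g h)

theorem lVertex_eq_sum (x : V) (hfin : {f | E.s f = x}.Finite) (hne : {f | E.s f = x}.Nonempty) :
    E.lVertex K x = ∑ f ∈ hfin.toFinset, E.lEdge K f * E.lGhost K f := by
  simpa only [map_mul, map_sum, lVertex, lEdge, lGhost, leavittGen] using
    RingQuot.mkAlgHom_rel K (LeavittRel.vertex_sum (E := E) (K := K) x hfin hne)

open Classical in
theorem lVertex_mul_lVertex (x y : V) :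
    E.lVertex K x * E.lVertex K y = if x = y then E.lVertex K y else 0 := by
  split_ifs with h
  · rw [h, lVertex_mul_self]
  · exact lVertex_mul_of_ne h

open Classical in
theorem lVertex_mul_lEdge_eq (x : V) (f : A) :
    E.lVertex K x * E.lEdge K f = if x = E.s f then E.lEdge K f else 0 := by
  rw [← lVertex_mul_lEdge, ← mul_assoc, lVertex_mul_lVertex]
  split_ifs <;> simp [lVertex_mul_lEdge]

open Classical in
theorem lGhost_mul_lVertex_eq (x : V) (f : A) :
    E.lGhost K f * E.lVertex K x = if E.s f = x then E.lGhost K f else 0 := by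
  rw [← lGhost_mul_lVertex, mul_assoc, lVertex_mul_lVertex]
  split_ifs with h
  · rw [← h, lGhost_mul_lVertex]
  · simp

theorem lPath_nil : E.lPath K [] = 1 := rfl

theorem lGhostPath_nil : E.lGhostPath K [] = 1 := rfl

theorem lPath_cons (f : A) (l : List A) :
    E.lPath K (f :: l) = E.lEdge K f * E.lPath K l := by
  simp [lPath]

theorem lGhostPath_cons (f : A) (l : List A) :
    E.lGhostPath K (f :: l) = E.lGhostPath K l * E.lGhost K f := by
  simp [lGhostPath]

theorem lPath_append (l l' : List A) :
    E.lPath K (l ++ l') = E.lPath K l * E.lPath K l' := by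
  simp [lPath]

theorem lGhostPath_append (l l' : List A) :
    E.lGhostPath K (l ++ l') = E.lGhostPath K l' * E.lGhostPath K l := by
  simp [lGhostPath]

theorem lPath_singleton (f : A) : E.lPath K [f] = E.lEdge K f := by simp [lPath]

theorem lGhostPath_singleton (f : A) : E.lGhostPath K [f] = E.lGhost K f := by simp [lGhostPath]

/-- Here `l` is any list of edges: the product `l* l` is `1` for the empty list, the range vertex
for a path and `0` otherwise. The last two identities allow `l` and `l*` to be recovered after
multiplication by the other one, which is how outer factors are removed in
`unitalHom_injective_homogeneous`. -/
theorem lGhostPath_mul_lPath (l : List A) :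
    (E.lGhostPath K l * E.lPath K l = 0 ∨ E.lGhostPath K l * E.lPath K l = 1 ∨
      ∃ x, E.lGhostPath K l * E.lPath K l = E.lVertex K x) ∧
    E.lPath K l * (E.lGhostPath K l * E.lPath K l) = E.lPath K l ∧
    E.lGhostPath K l * E.lPath K l * E.lGhostPath K l = E.lGhostPath K l := by
  classical
  induction l using List.reverseRecOn with
  | nil => simp [lPath_nil, lGhostPath_nil]
  | append_singleton l f ih =>
    simp only [lPath_append, lGhostPath_append, lPath_singleton, lGhostPath_singleton]
    set a := E.lPath K l
    set b := E.lGhostPath K l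
    have key : ∀ p : RingQuot (E.LeavittRel K), b * a = p →
        E.lGhost K f * b * (a * E.lEdge K f) = E.lGhost K f * p * E.lEdge K f := by
      rintro p rfl
      simp only [mul_assoc]
    obtain ⟨h0 | h1 | ⟨x, hx⟩, ha, hb⟩ := ih
    · rw [h0] at ha hb
      simp [ha.symm.trans (mul_zero a), hb.symm.trans (zero_mul b)]
    · rw [key 1 h1, mul_one, lGhost_mul_lEdge_self]
      exact ⟨Or.inr (Or.inr ⟨_, rfl⟩), by rw [mul_assoc, lEdge_mul_lVertex],
        by rw [← mul_assoc, lVertex_mul_lGhost]⟩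
    · rw [hx] at ha hb
      rw [key _ hx, lGhost_mul_lVertex_eq]
      split_ifs with h
      · rw [lGhost_mul_lEdge_self]
        exact ⟨Or.inr (Or.inr ⟨_, rfl⟩), by rw [mul_assoc, lEdge_mul_lVertex],
          by rw [← mul_assoc, lVertex_mul_lGhost]⟩
      · have h1 : a * E.lEdge K f = 0 := by
          rw [← ha, mul_assoc, lVertex_mul_lEdge_eq, if_neg (Ne.symm h), mul_zero]
        have h2 : E.lGhost K f * b = 0 := by
          rw [← hb, ← mul_assoc, lGhost_mul_lVertex_eq, if_neg h, zero_mul]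
        simp [h1, h2]

/-! ### Spanning by monomials -/

variable (E K) in
/-- The span of the monomials `l x l'*` for which `(l, l')` satisfies a condition. -/
noncomputable def monoSpan (p : List A → List A → Prop) : Submodule K (RingQuot (E.LeavittRel K)) :=
  Submodule.span K {y | ∃ l x l', p l l' ∧ y = E.lMono K l x l'}

theorem lMono_mem_monoSpan {p : List A → List A → Prop} {l l' : List A} (h : p l l') (x : V) :
    E.lMono K l x l' ∈ E.monoSpan K p :=
  Submodule.subset_span ⟨l, x, l', h, rfl⟩

/-- A linear map sends a span of monomials into a submodule if it does so for the monomials. -/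
theorem map_monoSpan_le {M : Type*} [AddCommGroup M] [Module K M]
    {p : List A → List A → Prop} (F : RingQuot (E.LeavittRel K) →ₗ[K] M) (N : Submodule K M)
    (h : ∀ l x l', p l l' → F (E.lMono K l x l') ∈ N) {y : RingQuot (E.LeavittRel K)}
    (hy : y ∈ E.monoSpan K p) : F y ∈ N := by
  have : E.monoSpan K p ≤ N.comap F := by
    refine Submodule.span_le.2 ?_
    rintro _ ⟨l, x, l', hl, rfl⟩
    exact h l x l' hl
  exact this hy

/-- Vertices fix or kill monomials, so every span `monoSpan p` is stable under them, whatever the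
condition `p`. -/
theorem lVertex_mul_lMono (y : V) (l : List A) (x : V) (l' : List A) :
    E.lVertex K y * E.lMono K l x l' = 0 ∨
      E.lVertex K y * E.lMono K l x l' = E.lMono K l x l' := by
  classical
  cases l with
  | nil =>
    rw [lMono, lPath_nil, one_mul, ← mul_assoc, lVertex_mul_lVertex]
    split_ifs <;> simp
  | cons f l =>
    rw [lMono, lPath_cons, ← mul_assoc, ← mul_assoc, ← mul_assoc, lVertex_mul_lEdge_eq]
    split_ifs <;> simp

theorem lMono_mul_lVertex (y : V) (l : List A) (x : V) (l' : List A) :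
    E.lMono K l x l' * E.lVertex K y = 0 ∨
      E.lMono K l x l' * E.lVertex K y = E.lMono K l x l' := by
  classical
  cases l' with
  | nil =>
    rw [lMono, lGhostPath_nil, mul_one, mul_assoc, lVertex_mul_lVertex]
    split_ifs with h <;> simp [h]
  | cons f l' =>
    rw [lMono, lGhostPath_cons, mul_assoc, mul_assoc, mul_assoc, lGhost_mul_lVertex_eq]
    split_ifs <;> simp [mul_assoc]

theorem lVertex_mul_mem {p : List A → List A → Prop} (x : V) {y : RingQuot (E.LeavittRel K)}
    (hy : y ∈ E.monoSpan K p) : E.lVertex K x * y ∈ E.monoSpan K p := by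
  refine map_monoSpan_le (LinearMap.mulLeft K (E.lVertex K x)) _ (fun l z l' h => ?_) hy
  rw [LinearMap.mulLeft_apply]
  rcases lVertex_mul_lMono (E := E) (K := K) x l z l' with h0 | h0 <;> rw [h0]
  · exact zero_mem _
  · exact lMono_mem_monoSpan h z

theorem mul_lVertex_mem {p : List A → List A → Prop} (x : V) {y : RingQuot (E.LeavittRel K)}
    (hy : y ∈ E.monoSpan K p) : y * E.lVertex K x ∈ E.monoSpan K p := by
  refine map_monoSpan_le (LinearMap.mulRight K (E.lVertex K x)) _ (fun l z l' h => ?_) hy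
  rw [LinearMap.mulRight_apply]
  rcases lMono_mul_lVertex (E := E) (K := K) x l z l' with h0 | h0 <;> rw [h0]
  · exact zero_mem _
  · exact lMono_mem_monoSpan h z

/-- An edge lengthens the left list. A ghost edge cancels against the first edge of that list, or
lengthens the ghost part if the list is empty. -/
theorem leavittGen_mul_mem (t : LeavittGen V A) {y : RingQuot (E.LeavittRel K)}
    (hy : y ∈ E.monoSpan K fun _ _ => True) :
    E.leavittGen K t * y ∈ E.monoSpan K fun _ _ => True := by
  classical
  cases t with
  | vertex x => exact lVertex_mul_mem x hy
  | edge f =>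
    refine map_monoSpan_le (LinearMap.mulLeft K (E.lEdge K f)) _ (fun l x l' _ => ?_) hy
    have h : E.lEdge K f * E.lMono K l x l' = E.lMono K (f :: l) x l' := by
      simp only [lMono, lPath_cons, mul_assoc]
    rw [LinearMap.mulLeft_apply, h]
    exact lMono_mem_monoSpan trivial x
  | ghost f =>
    refine map_monoSpan_le (LinearMap.mulLeft K (E.lGhost K f)) _ (fun l x l' _ => ?_) hy
    rw [LinearMap.mulLeft_apply]
    cases l with
    | nil =>
      rw [lMono, lPath_nil, one_mul, ← mul_assoc, lGhost_mul_lVertex_eq]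
      split_ifs
      -- A monomial must contain a vertex; `f* = r(f) f*` supplies it.
      · rw [← lGhostPath_singleton, ← lGhostPath_append, ← one_mul (E.lGhostPath K _),
          ← lPath_nil]
        have : E.lPath K [] * E.lGhostPath K (l' ++ [f]) = E.lMono K [] (E.r f) (l' ++ [f]) := by
          rw [lMono, lPath_nil, one_mul, one_mul, lGhostPath_append, lGhostPath_singleton,
            ← mul_assoc, lVertex_mul_lGhost]
        rw [this]
        exact lMono_mem_monoSpan trivial _
      · rw [zero_mul]
        exact zero_mem _
    | cons g l =>
      have h : E.lGhost K f * E.lMono K (g :: l) x l' =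
          E.lGhost K f * E.lEdge K g * E.lMono K l x l' := by
        simp only [lMono, lPath_cons, mul_assoc]
      rw [h]
      by_cases hfg : f = g
      · subst hfg
        rw [lGhost_mul_lEdge_self]
        exact lVertex_mul_mem _ (lMono_mem_monoSpan trivial x)
      · rw [lGhost_mul_lEdge_of_ne hfg, zero_mul]
        exact zero_mem _

theorem leavittGen_mem_monoSpan (t : LeavittGen V A) :
    E.leavittGen K t ∈ E.monoSpan K fun _ _ => True := by
  cases t with
  | vertex x =>
    have : E.leavittGen K (.vertex x) = E.lMono K [] x [] := by
      rw [lMono, lPath_nil, lGhostPath_nil, one_mul, mul_one, lVertex]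
    rw [this]
    exact lMono_mem_monoSpan trivial x
  | edge f =>
    have : E.leavittGen K (.edge f) = E.lMono K [f] (E.r f) [] := by
      rw [lMono, lPath_singleton, lGhostPath_nil, mul_one, lEdge_mul_lVertex, lEdge]
    rw [this]
    exact lMono_mem_monoSpan trivial _
  | ghost f =>
    have : E.leavittGen K (.ghost f) = E.lMono K [] (E.r f) [f] := by
      rw [lMono, lPath_nil, lGhostPath_singleton, one_mul, lVertex_mul_lGhost, lGhost]
    rw [this]
    exact lMono_mem_monoSpan trivial _

theorem leavittPathAlgebra_le_monoSpan {y : RingQuot (E.LeavittRel K)}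
    (hy : y ∈ E.leavittPathAlgebra K) : y ∈ E.monoSpan K fun _ _ => True := by
  -- Stability under left multiplication by `y` is carried along, since it is what makes the
  -- induction pass through products.
  suffices h : y ∈ E.monoSpan K (fun _ _ => True) ∧
      ∀ z ∈ E.monoSpan K (fun _ _ => True), y * z ∈ E.monoSpan K fun _ _ => True from h.1
  unfold leavittPathAlgebra at hy
  induction hy using NonUnitalAlgebra.adjoin_induction with
  | mem x hx =>
    obtain ⟨t, rfl⟩ := hx
    exact ⟨leavittGen_mem_monoSpan t, fun z hz => leavittGen_mul_mem t hz⟩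
  | add x y _ _ hx hy =>
    exact ⟨add_mem hx.1 hy.1, fun z hz => by rw [add_mul]; exact add_mem (hx.2 z hz) (hy.2 z hz)⟩
  | zero => exact ⟨zero_mem _, fun z _ => by rw [zero_mul]; exact zero_mem _⟩
  | mul x y _ _ hx hy =>
    exact ⟨hx.2 _ hy.1, fun z hz => by rw [mul_assoc]; exact hx.2 _ (hy.2 z hz)⟩
  | smul k x _ hx =>
    exact ⟨Submodule.smul_mem _ _ hx.1, fun z hz => by
      rw [smul_mul_assoc]; exact Submodule.smul_mem _ _ (hx.2 z hz)⟩

/-! ### The diagonal -/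

/-- A monomial `g m x m* g*` loses `g` on both sides if `g = f` and vanishes otherwise. A bare
vertex cannot become shorter and yields `r(f)` or `0`; it fits because the new bound `n + 1` is
positive. -/
theorem lGhost_mul_lMono_mul_lEdge (f : A) {n : ℕ} {y : RingQuot (E.LeavittRel K)}
    (hy : y ∈ E.monoSpan K fun l l' => l = l' ∧ l.length < n + 2) :
    E.lGhost K f * y * E.lEdge K f ∈ E.monoSpan K fun l l' => l = l' ∧ l.length < n + 1 := by
  classical
  refine map_monoSpan_le
    ((LinearMap.mulRight K (E.lEdge K f)).comp (LinearMap.mulLeft K (E.lGhost K f)))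
    _ (fun l x l' h => ?_) hy
  obtain ⟨rfl, h⟩ := h
  change E.lGhost K f * E.lMono K l x l * E.lEdge K f ∈ _
  cases l with
  | nil =>
    rw [lMono, lPath_nil, one_mul, lGhostPath_nil, mul_one, lGhost_mul_lVertex_eq]
    split_ifs
    · have : E.lGhost K f * E.lEdge K f = E.lMono K [] (E.r f) [] := by
        rw [lMono, lPath_nil, lGhostPath_nil, one_mul, mul_one, lGhost_mul_lEdge_self]
      rw [this]
      exact lMono_mem_monoSpan ⟨rfl, by simp⟩ _
    · rw [zero_mul]
      exact zero_mem _
  | cons g l =>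
    have h' : E.lGhost K f * E.lMono K (g :: l) x (g :: l) * E.lEdge K f =
        (E.lGhost K f * E.lEdge K g) * E.lMono K l x l * (E.lGhost K g * E.lEdge K f) := by
      simp only [lMono, lPath_cons, lGhostPath_cons, mul_assoc]
    rw [h']
    by_cases hfg : f = g
    · subst hfg
      rw [lGhost_mul_lEdge_self]
      exact mul_lVertex_mem _ (lVertex_mul_mem _ (lMono_mem_monoSpan
        ⟨rfl, by simpa using h⟩ x))
    · rw [lGhost_mul_lEdge_of_ne hfg, zero_mul, zero_mul]
      exact zero_mem _

/-- The projection `f f*` is absorbed on either side by a diagonal monomial whose list begins with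
`f`, and kills on either side one that begins with another edge. Against a vertex `x`, both products
are `f f*` or both are `0`. -/
theorem lEdge_mul_lGhost_commute (f : A) {y : RingQuot (E.LeavittRel K)}
    (hy : y ∈ E.monoSpan K fun l l' => l = l') :
    E.lEdge K f * E.lGhost K f * y = y * (E.lEdge K f * E.lGhost K f) := by
  classical
  have h := map_monoSpan_le (LinearMap.mulLeft K (E.lEdge K f * E.lGhost K f) -
    LinearMap.mulRight K (E.lEdge K f * E.lGhost K f)) ⊥ (fun l x l' h => ?_) hy
  · simpa [sub_eq_zero, mul_assoc] using h
  obtain rfl := h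
  rw [Submodule.mem_bot, LinearMap.sub_apply, LinearMap.mulLeft_apply, LinearMap.mulRight_apply,
    sub_eq_zero]
  cases l with
  | nil =>
    rw [lMono, lPath_nil, one_mul, lGhostPath_nil, mul_one, mul_assoc, lGhost_mul_lVertex_eq,
      ← mul_assoc, lVertex_mul_lEdge_eq]
    by_cases h : E.s f = x
    · simp [h]
    · simp [h, Ne.symm h]
  | cons g l =>
    have h1 : E.lEdge K f * E.lGhost K f * E.lMono K (g :: l) x (g :: l) =
        E.lEdge K f * (E.lGhost K f * E.lEdge K g) * E.lMono K l x l * E.lGhost K g := by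
      simp only [lMono, lPath_cons, lGhostPath_cons, mul_assoc]
    have h2 : E.lMono K (g :: l) x (g :: l) * (E.lEdge K f * E.lGhost K f) =
        E.lEdge K g * E.lMono K l x l * (E.lGhost K g * E.lEdge K f) * E.lGhost K f := by
      simp only [lMono, lPath_cons, lGhostPath_cons, mul_assoc]
    rw [h1, h2]
    by_cases hfg : f = g
    · subst hfg
      rw [lGhost_mul_lEdge_self, lEdge_mul_lVertex, mul_assoc _ (E.lVertex K _),
        lVertex_mul_lGhost]
    · rw [lGhost_mul_lEdge_of_ne hfg, lGhost_mul_lEdge_of_ne (Ne.symm hfg)]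
      simp

open Filter in
-- Finite sums of vertices are approximate units: a monomial is fixed by one vertex and killed by
-- the others. Stated for all large finite sets, the property is additive.
theorem eventually_sum_lVertex_mul {y : RingQuot (E.LeavittRel K)}
    (hy : y ∈ E.monoSpan K fun l l' => l = l') :
    ∀ᶠ S : Finset V in atTop, ∑ x ∈ S, E.lVertex K x * y = y := by
  classical
  induction hy using Submodule.span_induction with
  | mem y h =>
    obtain ⟨l, x, l', -, rfl⟩ := h
    obtain ⟨v, hv⟩ : ∃ v, E.lVertex K v * E.lMono K l x l' = E.lMono K l x l' := by
      cases l with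
      | nil => exact ⟨x, by rw [lMono, lPath_nil, one_mul, ← mul_assoc, lVertex_mul_self]⟩
      | cons g l =>
        exact ⟨E.s g, by simp only [lMono, lPath_cons, ← mul_assoc, lVertex_mul_lEdge]⟩
    filter_upwards [eventually_ge_atTop {v}] with S hS
    rw [Finset.sum_eq_single_of_mem v (hS (by simp)), hv]
    intro y _ hy
    rw [← hv, ← mul_assoc, lVertex_mul_of_ne hy, zero_mul]
  | zero => simp
  | add y z _ _ hy hz =>
    filter_upwards [hy, hz] with S h1 h2
    simp only [mul_add, Finset.sum_add_distrib, h1, h2]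
  | smul k y _ hy =>
    filter_upwards [hy] with S h
    simp only [mul_smul_comm, ← Finset.smul_sum, h]

open Filter in
-- Splits `v y` into the contribution `k v` of the monomials of length zero and the contribution `z`
-- of the longer ones. Each longer monomial begins with an edge `g`, so it is fixed by `g g*` and
-- killed by the other `f f*`; hence `z` is a finite sum of the `f f* z`, even if `v` emits
-- infinitely many edges.
theorem exists_lVertex_mul_eq (v : V) {y : RingQuot (E.LeavittRel K)}
    (hy : y ∈ E.monoSpan K fun l l' => l = l') :
    ∃ (k : K) (z : RingQuot (E.LeavittRel K)), E.lVertex K v * y = k • E.lVertex K v + z ∧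
      E.lVertex K v * z = z ∧
      ∀ᶠ F : Finset A in atTop, ∑ f ∈ F, E.lEdge K f * (E.lGhost K f * z) = z := by
  classical
  induction hy using Submodule.span_induction with
  | mem y h =>
    obtain ⟨l, x, -, rfl, rfl⟩ := h
    cases l with
    | nil =>
      by_cases hvx : v = x
      · subst hvx
        refine ⟨1, 0, ?_, by simp, by simp⟩
        simp [lMono, lPath_nil, lGhostPath_nil, lVertex_mul_self]
      · refine ⟨0, 0, ?_, by simp, by simp⟩
        simp [lMono, lPath_nil, lGhostPath_nil, lVertex_mul_of_ne hvx]
    | cons g l =>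
      refine ⟨0, E.lVertex K v * E.lMono K (g :: l) x (g :: l), by simp, ?_, ?_⟩
      · rw [← mul_assoc, lVertex_mul_self]
      · rcases lVertex_mul_lMono (E := E) (K := K) v (g :: l) x (g :: l) with h0 | h0 <;> rw [h0]
        · simp
        filter_upwards [eventually_ge_atTop {g}] with F hF
        rw [Finset.sum_eq_single_of_mem g (hF (by simp))]
        · simp only [lMono, lPath_cons, mul_assoc]
          rw [← mul_assoc (E.lGhost K g), lGhost_mul_lEdge_self, ← mul_assoc (E.lEdge K g),
            lEdge_mul_lVertex]
        · intro f _ hf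
          simp only [lMono, lPath_cons, mul_assoc]
          rw [← mul_assoc (E.lGhost K f), lGhost_mul_lEdge_of_ne hf, zero_mul, mul_zero]
  | zero => exact ⟨0, 0, by simp, by simp, by simp⟩
  | add y y' _ _ hy hy' =>
    obtain ⟨k, z, h1, h2, h3⟩ := hy
    obtain ⟨k', z', h1', h2', h3'⟩ := hy'
    refine ⟨k + k', z + z', by rw [mul_add, h1, h1', add_smul]; abel,
      by rw [mul_add, h2, h2'], ?_⟩
    filter_upwards [h3, h3'] with F h h'
    simp only [mul_add, Finset.sum_add_distrib, h, h']
  | smul c y _ hy =>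
    obtain ⟨k, z, h1, h2, h3⟩ := hy
    refine ⟨c * k, c • z, by rw [mul_smul_comm, h1, smul_add, smul_smul],
      by rw [mul_smul_comm, h2], ?_⟩
    filter_upwards [h3] with F h
    simp only [mul_smul_comm, ← Finset.smul_sum, h]

end DirGraph

/-! ### Bijectivity of the homomorphism. -/

namespace DirGraph

variable {V : Type u} {A : Type v} {E : DirGraph V A} {K : Type w} [Field K]

/-- Every vertex is the source of an element of `X`. -/
theorem exists_boundary_src (E : DirGraph V A) (x : V) : ∃ ξ : E.Boundary, ξ.src = x := by
  by_cases hs : E.IsSink x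
  · exact ⟨.sink x hs, rfl⟩
  -- An outgoing edge is chosen at every vertex that is not a sink; following the choices from `x`
  -- either reaches a sink or gives an infinite path. At a sink the choice is a dummy, available
  -- because `x` emits an edge.
  have hc : ∀ y, ∃ f, ¬ E.IsSink y → E.s f = y := by
    intro y
    by_cases hy : E.IsSink y
    · obtain ⟨f, hf⟩ := not_forall_not.1 hs
      exact ⟨f, fun h => absurd hy h⟩
    · obtain ⟨f, hf⟩ := not_forall_not.1 hy
      exact ⟨f, fun _ => hf⟩
  choose c hc using hc
  by_cases h : ∃ n, E.IsSink ((fun y => E.r (c y))^[n] x)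
  · obtain ⟨n, hn⟩ := h
    clear hs
    induction n generalizing x with
    | zero => exact ⟨.sink x hn, rfl⟩
    | succ n ih =>
      by_cases hs : E.IsSink x
      · exact ⟨.sink x hs, rfl⟩
      obtain ⟨ξ, hξ⟩ := ih (E.r (c x)) hn
      exact ⟨ξ.cons (c x) hξ, (Boundary.src_cons _ _ _).trans (hc x hs)⟩
  · refine ⟨.inf (fun n => c ((fun y => E.r (c y))^[n] x)) fun i => ?_, hc x hs⟩
    rw [hc _ fun hi => h ⟨i + 1, hi⟩, Function.iterate_succ_apply']

section Hom

variable (hE : ∀ x : V, ¬ E.IsIsolated x)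

theorem unitalHom_lVertex (x : V) :
    unitalHom K hE (E.lVertex K x) = Unitization.inr (E.skewVertex K x (hE x)) :=
  unitalHom_leavittGen hE _

theorem unitalHom_lEdge (f : A) :
    unitalHom K hE (E.lEdge K f) = Unitization.inr (E.skewEdge K f) :=
  unitalHom_leavittGen hE _

theorem unitalHom_lGhost (f : A) :
    unitalHom K hE (E.lGhost K f) = Unitization.inr (E.skewGhost K f) :=
  unitalHom_leavittGen hE _

/-- The coefficient of `δ_1` in the image is `k 1_x`, which takes the value `k` at any boundary
point with source `x`, and there is one by `exists_boundary_src`. -/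
theorem eq_zero_of_unitalHom_smul_lVertex (x : V) (k : K)
    (h : unitalHom K hE (k • E.lVertex K x) = 0) : k = 0 := by
  rw [map_smul, unitalHom_lVertex, ← Unitization.inr_smul, ← Unitization.inr_zero K] at h
  have h1 := Unitization.inr_injective h
  rw [skewVertex, ← map_smul] at h1
  have h2 := congrArg ((E.betaAction K).coeff 1) h1
  rw [AlgPartialAction.coeff_delta_self, map_zero] at h2
  obtain ⟨ξ, hξ⟩ := exists_boundary_src E x
  have h3 := congrFun (congrArg
    (fun z : (E.betaAction K).D 1 => ((z : E.DsX K) : E.Boundary → K)) h2) ξ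
  change k * Set.indicator _ _ ξ = 0 at h3
  rwa [Set.indicator_of_mem (by exact hξ), Pi.one_apply, mul_one] at h3

/-! ### Injectivity -/

theorem exists_smul_lVertex (v : V) {y : RingQuot (E.LeavittRel K)}
    (hy : y ∈ E.monoSpan K fun l l' => l = l' ∧ l.length < 1) :
    ∃ k : K, E.lVertex K v * y = k • E.lVertex K v := by
  have h := map_monoSpan_le (LinearMap.mulLeft K (E.lVertex K v)) (K ∙ E.lVertex K v)
    (fun l x l' h => ?_) hy
  · obtain ⟨k, hk⟩ := Submodule.mem_span_singleton.1 h
    exact ⟨k, hk.symm⟩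
  · classical
    obtain ⟨rfl, h⟩ := h
    obtain rfl : l = [] := by simpa using h
    rw [LinearMap.mulLeft_apply, lMono, lPath_nil, lGhostPath_nil, one_mul, mul_one]
    by_cases hvx : v = x
    · rw [hvx, lVertex_mul_self]
      exact Submodule.mem_span_singleton_self _
    · rw [lVertex_mul_of_ne hvx]
      exact zero_mem _

theorem monoSpan_mono {p q : List A → List A → Prop} (h : ∀ l l', p l l' → q l l') :
    E.monoSpan K p ≤ E.monoSpan K q :=
  Submodule.span_mono fun _ ⟨l, x, l', hl, hy⟩ => ⟨l, x, l', h _ _ hl, hy⟩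

theorem eq_zero_of_lVertex_mul {y : RingQuot (E.LeavittRel K)}
    (hy : y ∈ E.monoSpan K fun l l' => l = l') (h : ∀ v, E.lVertex K v * y = 0) : y = 0 := by
  obtain ⟨S, hS⟩ := (eventually_sum_lVertex_mul hy).exists
  rw [← hS]
  exact Finset.sum_eq_zero fun v _ => h v

/-- In the induction step `f* y f` is a shorter kernel element, so it vanishes, and this forces `f*
y = 0` for all edges `f`. It remains to deduce `v y = 0` for each vertex `v`, with an argument that
depends on what `v` emits. -/
theorem unitalHom_injective_diagonal_aux (n : ℕ) {y : RingQuot (E.LeavittRel K)}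
    (hy : y ∈ E.monoSpan K fun l l' => l = l' ∧ l.length < n + 1)
    (h0 : unitalHom K hE y = 0) : y = 0 := by
  induction n generalizing y with
  | zero =>
    refine eq_zero_of_lVertex_mul (monoSpan_mono (fun _ _ h => h.1) hy) fun v => ?_
    obtain ⟨k, hk⟩ := exists_smul_lVertex v hy
    have : unitalHom K hE (k • E.lVertex K v) = 0 := by rw [← hk, map_mul, h0, mul_zero]
    rw [hk, eq_zero_of_unitalHom_smul_lVertex hE v k this, zero_smul]
  | succ n ih =>
    have hd := monoSpan_mono (fun _ _ h => h.1) hy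
    have hg : ∀ f, E.lGhost K f * y = 0 := by
      intro f
      have h1 : E.lGhost K f * y * E.lEdge K f = 0 :=
        ih (lGhost_mul_lMono_mul_lEdge f hy) (by rw [map_mul, map_mul, h0, mul_zero, zero_mul])
      -- Commuting `f f*` past `y` makes the vanishing factor `f* y f` appear.
      calc E.lGhost K f * y = E.lGhost K f * (E.lEdge K f * E.lGhost K f * y) := by
            rw [← mul_assoc, ← mul_assoc, lGhost_mul_lEdge_self, lVertex_mul_lGhost]
        _ = E.lGhost K f * y * E.lEdge K f * E.lGhost K f := by
            rw [lEdge_mul_lGhost_commute f hd]; simp only [mul_assoc]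
        _ = 0 := by rw [h1, zero_mul]
    refine eq_zero_of_lVertex_mul hd fun v => ?_
    obtain ⟨k, z, hk, hvz, hF⟩ := exists_lVertex_mul_eq v hd
    obtain ⟨F, hF⟩ := hF.exists
    by_cases hinf : E.IsInfiniteEmitter v
    -- An edge `f` from `v` outside `F` gives `f* z = 0`, so `0 = f* v y = k f*`. Multiplying by `f`
    -- yields `k r(f) = 0`, whence `k = 0`.
    · obtain ⟨f, hfv, hfF⟩ := hinf.exists_notMem_finset F
      have hfv : E.s f = v := hfv
      have h1 : E.lGhost K f * z = 0 := by
        rw [← hF, Finset.mul_sum]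
        refine Finset.sum_eq_zero fun g hg' => ?_
        rw [← mul_assoc, lGhost_mul_lEdge_of_ne (fun h => hfF (by rwa [h])), zero_mul]
      have h2 : k • E.lVertex K (E.r f) = 0 := by
        have h3 : E.lGhost K f * (E.lVertex K v * y) = 0 := by
          rw [← mul_assoc, ← hfv, lGhost_mul_lVertex, hg]
        rw [hk, mul_add, h1, add_zero, mul_smul_comm, ← hfv, lGhost_mul_lVertex] at h3
        rw [← lGhost_mul_lEdge_self, ← smul_mul_assoc, h3, zero_mul]
      have hk0 := eq_zero_of_unitalHom_smul_lVertex hE _ k (by rw [h2, map_zero])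
      rw [hk0, zero_smul, zero_add] at hk
      rw [hk, ← hF]
      -- Now `z = v y`, and `g* v` is `g*` or `0`, so every term contains `g* y = 0` or vanishes
      -- outright.
      refine Finset.sum_eq_zero fun g _ => ?_
      classical
      rw [← hk, ← mul_assoc (E.lGhost K g), lGhost_mul_lVertex_eq]
      split_ifs
      · rw [hg, mul_zero]
      · rw [zero_mul, mul_zero]
    by_cases hs : E.IsSink v
    -- No edge leaves a sink, so `v g = 0` for every edge `g`, and `z = ∑ v g g* z` vanishes.
    · have hz : z = 0 := by
        rw [← hvz, ← hF, Finset.mul_sum]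
        classical
        refine Finset.sum_eq_zero fun g _ => ?_
        rw [← mul_assoc, lVertex_mul_lEdge_eq, if_neg (Ne.symm (hs g)), zero_mul]
      rw [hz, add_zero] at hk
      rw [hk, eq_zero_of_unitalHom_smul_lVertex hE v k (by rw [← hk, map_mul, h0, mul_zero]),
        zero_smul]
    · have hne : {f | E.s f = v}.Nonempty := by
        obtain ⟨f, hf⟩ := not_forall_not.1 hs
        exact ⟨f, hf⟩
      -- At a regular vertex `v y = ∑ f f* y`, and every `f* y` is zero.
      rw [lVertex_eq_sum v (Set.not_infinite.1 hinf) hne, Finset.sum_mul]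
      exact Finset.sum_eq_zero fun f _ => by rw [mul_assoc, hg, mul_zero]

theorem unitalHom_injective_diagonal {y : RingQuot (E.LeavittRel K)}
    (hy : y ∈ E.monoSpan K fun l l' => l = l') (h0 : unitalHom K hE y = 0) : y = 0 := by
  have h : ∃ n : ℕ, y ∈ E.monoSpan K fun l l' => l = l' ∧ l.length < n + 1 := by
    clear h0
    induction hy using Submodule.span_induction with
    | mem y h =>
      obtain ⟨l, x, l', rfl, rfl⟩ := h
      exact ⟨l.length, lMono_mem_monoSpan ⟨rfl, Nat.lt_succ_self _⟩ x⟩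
    | zero => exact ⟨0, zero_mem _⟩
    | add y z _ _ hy hz =>
      obtain ⟨m, hm⟩ := hy
      obtain ⟨n, hn⟩ := hz
      exact ⟨m + n, add_mem (monoSpan_mono (fun _ _ h => ⟨h.1, by omega⟩) hm)
        (monoSpan_mono (fun _ _ h => ⟨h.1, by omega⟩) hn)⟩
    | smul k y _ hy =>
      obtain ⟨n, hn⟩ := hy
      exact ⟨n, Submodule.smul_mem _ _ hn⟩
  obtain ⟨n, hn⟩ := h
  exact unitalHom_injective_diagonal_aux hE n hn h0

/-- Cancelling the common suffix is the reduction of `l l'⁻¹` in the free group, to which the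
uniqueness in `quot_injective` then applies. -/
theorem exists_strip_common_suffix (l l' : List A) : ∃ l₀ l₀' c : List A,
    l = l₀ ++ c ∧ l' = l₀' ++ c ∧ ∀ f ∈ l₀.getLast?, ∀ g ∈ l₀'.getLast?, f ≠ g := by
  induction l using List.reverseRecOn generalizing l' with
  | nil => exact ⟨[], l', [], rfl, by simp, by simp⟩
  | append_singleton l f ih =>
    rcases List.eq_nil_or_concat l' with rfl | ⟨l', g, rfl⟩
    · exact ⟨l ++ [f], [], [], by simp, rfl, by simp⟩
    by_cases hfg : f = g
    · subst hfg
      obtain ⟨l₀, l₀', c, rfl, rfl, h⟩ := ih l'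
      exact ⟨l₀, l₀', c ++ [f], by simp, by simp, h⟩
    · exact ⟨l ++ [f], l' ++ [g], [], by simp, by simp, by simpa using hfg⟩

/-- The degree of the monomial `l x l'*` in the free group. -/
def wordDegree (l l' : List A) : FreeGroup A :=
  (l.map FreeGroup.of).prod * ((l'.map FreeGroup.of).prod)⁻¹

/-- The reduced form `g = l l'⁻¹` is unique, so every monomial of degree `g` is `l c x c* l'*` with
the same `l` and `l'`; only the common suffix `c` varies, and the middle factors are diagonal. -/
theorem exists_eq_lPath_mul_mul {g : FreeGroup A} {y : RingQuot (E.LeavittRel K)}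
    (hy : y ∈ E.monoSpan K fun l l' => wordDegree l l' = g) :
    ∃ l l', ∃ z ∈ E.monoSpan K fun l l' => l = l',
      y = E.lPath K l * z * E.lGhostPath K l' := by
  by_cases h : ∃ l l' : List A, (∀ f ∈ l.getLast?, ∀ g ∈ l'.getLast?, f ≠ g) ∧
      wordDegree l l' = g
  · obtain ⟨l, l', hred, rfl⟩ := h
    set F : RingQuot (E.LeavittRel K) →ₗ[K] RingQuot (E.LeavittRel K) :=
      (LinearMap.mulRight K (E.lGhostPath K l')).comp (LinearMap.mulLeft K (E.lPath K l)) with hF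
    have h1 := map_monoSpan_le LinearMap.id
      ((E.monoSpan K fun l l' => l = l').map F) (fun m x m' h => ?_) hy
    · obtain ⟨z, hz, hzy⟩ := h1
      exact ⟨l, l', z, hz, hzy.symm⟩
    · obtain ⟨m₀, m₀', c, rfl, rfl, hm⟩ := exists_strip_common_suffix m m'
      have h2 : wordDegree m₀ m₀' = wordDegree l l' := by
        rw [← h]
        simp [wordDegree, mul_assoc]
      obtain ⟨rfl, rfl⟩ := quot_injective hm hred h2
      refine ⟨_, lMono_mem_monoSpan (p := fun l l' => l = l') (rfl : c = c) x, ?_⟩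
      simp [hF, lMono, lPath_append, lGhostPath_append, mul_assoc]
  -- If `g` has no such form, no monomial has degree `g`, and the span is zero.
  · refine ⟨[], [], 0, zero_mem _, ?_⟩
    have h1 := map_monoSpan_le LinearMap.id ⊥ (fun m x m' hm => ?_) hy
    · simpa using h1
    · obtain ⟨m₀, m₀', c, rfl, rfl, hred⟩ := exists_strip_common_suffix m m'
      refine absurd ⟨m₀, m₀', hred, ?_⟩ h
      rw [← hm]
      simp [wordDegree, mul_assoc]

/-- Writing the element as `l z l'*`, multiplication by `l*` and `l'` gives a diagonal kernel
element `p z p'` with `p = l* l` and `p' = l'* l'`, which vanishes. Nothing is lost, because `l p =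
l` and `p' l'* = l'*`. -/
theorem unitalHom_injective_homogeneous {g : FreeGroup A} {y : RingQuot (E.LeavittRel K)}
    (hy : y ∈ E.monoSpan K fun l l' => wordDegree l l' = g) (h0 : unitalHom K hE y = 0) :
    y = 0 := by
  obtain ⟨l, l', z, hz, rfl⟩ := exists_eq_lPath_mul_mul hy
  obtain ⟨hp, hl, -⟩ := lGhostPath_mul_lPath (E := E) (K := K) l
  obtain ⟨hp', -, hl'⟩ := lGhostPath_mul_lPath (E := E) (K := K) l'
  set p := E.lGhostPath K l * E.lPath K l with hpdef
  set p' := E.lGhostPath K l' * E.lPath K l' with hpdef'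
  have h1 : p * z * p' ∈ E.monoSpan K fun l l' => l = l' := by
    have h2 : p * z ∈ E.monoSpan K fun l l' => l = l' := by
      rcases hp with h | h | ⟨x, h⟩ <;> rw [h]
      · rw [zero_mul]; exact zero_mem _
      · rwa [one_mul]
      · exact lVertex_mul_mem x hz
    rcases hp' with h | h | ⟨x, h⟩ <;> rw [h]
    · rw [mul_zero]; exact zero_mem _
    · rwa [mul_one]
    · exact mul_lVertex_mem x h2
  have h3 : p * z * p' = E.lGhostPath K l * (E.lPath K l * z * E.lGhostPath K l') *
      E.lPath K l' := by
    simp only [hpdef, hpdef', mul_assoc]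
  have h4 : p * z * p' = 0 := by
    refine unitalHom_injective_diagonal hE h1 ?_
    rw [h3, map_mul, map_mul, h0, mul_zero, zero_mul]
  calc E.lPath K l * z * E.lGhostPath K l'
      = E.lPath K l * p * z * (p' * E.lGhostPath K l') := by rw [hl, hl']
    _ = E.lPath K l * (p * z * p') * E.lGhostPath K l' := by simp only [mul_assoc]
    _ = 0 := by rw [h4, mul_zero, zero_mul]

variable (E K) in
/-- The homogeneous elements of degree `g` in the unitization of the partial skew group ring. -/
noncomputable def skewHomogeneous (g : FreeGroup A) :
    Submodule K (Unitization K (E.betaAction K).SkewGroupRing) :=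
  LinearMap.range ((Unitization.inrHom K K (E.betaAction K).SkewGroupRing).comp
    ((E.betaAction K).delta g))

theorem mem_skewHomogeneous (g : FreeGroup A)
    (y : Unitization K (E.betaAction K).SkewGroupRing) : y ∈ E.skewHomogeneous K g ↔
      ∃ d, Unitization.inr ((E.betaAction K).delta g d) = y := Iff.rfl

theorem mul_mem_skewHomogeneous {g h : FreeGroup A}
    {x y : Unitization K (E.betaAction K).SkewGroupRing} (hx : x ∈ E.skewHomogeneous K g)
    (hy : y ∈ E.skewHomogeneous K h) : x * y ∈ E.skewHomogeneous K (g * h) := by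
  obtain ⟨d, rfl⟩ := hx
  obtain ⟨e, rfl⟩ := hy
  refine ⟨(E.betaAction K).mulHomogeneous g h d e, ?_⟩
  change Unitization.inr _ = Unitization.inr _ * Unitization.inr _
  rw [← Unitization.inr_mul, AlgPartialAction.delta_mul_delta]

theorem unitalHom_mem_skewHomogeneous {g : FreeGroup A} {y : RingQuot (E.LeavittRel K)}
    (hy : y ∈ E.monoSpan K fun l l' => wordDegree l l' = g) :
    unitalHom K hE y ∈ E.skewHomogeneous K g := by
  refine map_monoSpan_le (unitalHom K hE).toLinearMap _ (fun l x l' h => ?_) hy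
  clear hy
  subst h
  change unitalHom K hE _ ∈ _
  -- The vertex is kept with the ghost path: an empty path alone would be sent to the unit of the
  -- unitization, which is not in a homogeneous component.
  have hghost : unitalHom K hE (E.lVertex K x * E.lGhostPath K l') ∈
      E.skewHomogeneous K ((l'.map FreeGroup.of).prod)⁻¹ := by
    induction l' with
    | nil =>
      rw [lGhostPath_nil, mul_one, unitalHom_lVertex]
      simp only [List.map_nil, List.prod_nil, inv_one]
      exact ⟨_, rfl⟩
    | cons f l' ih =>
      rw [lGhostPath_cons, ← mul_assoc, map_mul, List.map_cons, List.prod_cons, mul_inv_rev]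
      refine mul_mem_skewHomogeneous ih ?_
      rw [unitalHom_lGhost]
      exact ⟨_, rfl⟩
  rw [lMono, wordDegree, mul_assoc]
  induction l with
  | nil => simpa [lPath_nil] using hghost
  | cons f l ih =>
    rw [lPath_cons, mul_assoc, map_mul, List.map_cons, List.prod_cons, mul_assoc]
    refine mul_mem_skewHomogeneous ?_ ih
    rw [unitalHom_lEdge]
    exact ⟨_, rfl⟩

/-- A sum of homogeneous elements of distinct degrees is sent to elements of distinct summands `D_g
δ_g`. If the total is zero, comparing coefficients shows that each component is in the kernel, so
the homogeneous case applies. -/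
theorem unitalHom_injective {y : RingQuot (E.LeavittRel K)}
    (hy : y ∈ E.leavittPathAlgebra K) (h0 : unitalHom K hE y = 0) : y = 0 := by
  have h1 : y ∈ ⨆ g : FreeGroup A, E.monoSpan K fun l l' => wordDegree l l' = g :=
    map_monoSpan_le LinearMap.id _ (fun l x l' _ => Submodule.mem_iSup_of_mem (wordDegree l l')
      (lMono_mem_monoSpan (p := fun m m' => wordDegree m m' = wordDegree l l') rfl x))
      (leavittPathAlgebra_le_monoSpan hy)
  obtain ⟨F, hF, rfl⟩ := (Submodule.mem_iSup_iff_exists_finsupp _ _).1 h1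
  refine Finset.sum_eq_zero fun g hg => unitalHom_injective_homogeneous hE (hF g) ?_
  choose d hd using fun h =>
    (mem_skewHomogeneous _ _).1 (unitalHom_mem_skewHomogeneous hE (hF h))
  have h2 : (E.betaAction K).coeff g (∑ h ∈ F.support, (E.betaAction K).delta h (d h)) = 0 := by
    have h3 : ∑ h ∈ F.support, (E.betaAction K).delta h (d h) = 0 := by
      refine Unitization.inr_injective (R := K) ?_
      rw [Unitization.inr_zero, ← h0, Finsupp.sum, map_sum]
      simp only [← hd]
      exact map_sum (Unitization.inrHom K K (E.betaAction K).SkewGroupRing) _ _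
    rw [h3, map_zero]
  rw [map_sum, Finset.sum_eq_single_of_mem g hg, AlgPartialAction.coeff_delta_self] at h2
  · rw [← hd g, h2, map_zero, Unitization.inr_zero]
  · intro h _ hne
    exact AlgPartialAction.coeff_delta_ne _ (Ne.symm hne) _

/-! ### Surjectivity -/

/-- The generators have no scalar part in the unitization, and such elements form a non-unital
subalgebra. This brings the image back to the skew group ring itself. -/
theorem unitalHom_fst {y : RingQuot (E.LeavittRel K)} (hy : y ∈ E.leavittPathAlgebra K) :
    (unitalHom K hE y).toProd.1 = 0 := by
  unfold leavittPathAlgebra at hy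
  induction hy using NonUnitalAlgebra.adjoin_induction with
  | mem x hx =>
    obtain ⟨t, rfl⟩ := hx
    rw [unitalHom_leavittGen, Unitization.fst_inr]
  | add x y _ _ hx hy => rw [map_add, Unitization.fst_add, hx, hy, add_zero]
  | zero => rw [map_zero, Unitization.fst_zero]
  | mul x y _ _ hx hy => rw [map_mul, Unitization.fst_mul, hx, zero_mul]
  | smul k x _ hx => rw [map_smul, Unitization.fst_smul, hx, smul_zero]

theorem unitalHom_eq_inr {y : RingQuot (E.LeavittRel K)} (hy : y ∈ E.leavittPathAlgebra K) :
    unitalHom K hE y = Unitization.inr (unitalHom K hE y).toProd.2 :=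
  Unitization.ext (by rw [unitalHom_fst hE hy, Unitization.fst_inr]) (by rw [Unitization.snd_inr])

/-- The image of the Leavitt path algebra in the partial skew group ring. -/
noncomputable def leavittImage : NonUnitalSubalgebra K (E.betaAction K).SkewGroupRing :=
  ((E.leavittPathAlgebra K).map (unitalHom K hE)).comap
    (Unitization.inrNonUnitalAlgHom K (E.betaAction K).SkewGroupRing)

theorem mem_leavittImage (s : (E.betaAction K).SkewGroupRing) : s ∈ leavittImage (K := K) hE ↔
    ∃ y ∈ E.leavittPathAlgebra K, unitalHom K hE y = Unitization.inr s := by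
  rw [leavittImage, NonUnitalSubalgebra.mem_comap, NonUnitalSubalgebra.mem_map]
  rfl

theorem skewGen_mem_leavittImage (t : LeavittGen V A) :
    skewGen K hE t ∈ leavittImage (K := K) hE :=
  (mem_leavittImage hE _).2 ⟨_, NonUnitalAlgebra.subset_adjoin K ⟨t, rfl⟩,
    unitalHom_leavittGen hE t⟩

theorem skewEdge_mul_mul_skewGhost (f : A) (d e : (E.betaAction K).D 1)
    (h : E.push K f ((d : E.DsX K) : E.Boundary → K) = (e : E.DsX K)) :
    E.skewEdge K f * ((E.betaAction K).delta 1 d * E.skewGhost K f) =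
      (E.betaAction K).delta 1 e := by
  rw [skewGhost, AlgPartialAction.delta_one_mul_delta]
  refine skewEdge_mul_delta f _ _ _ _ (mul_inv_cancel _) ?_
  refine (push_mul f _ _).trans ?_
  change _ * E.push K f (E.one K _) = _
  rw [push_one_inv, mul_comm, one_mul_push, h]

/-- The cylinder of a path `a` corresponds to `a a*`. By induction on its length, conjugating with
an edge `f` pushes the cylinder of the tail forward to the cylinder of the longer path. -/
theorem delta_one_indicator_mem_leavittImage (S : Set E.Boundary) (hS : E.IsBasic S)
    (h : (S.indicator 1 : E.Boundary → K) ∈ E.DsX K) :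
    (E.betaAction K).delta 1 ⟨⟨_, h⟩, mem_D_one _⟩ ∈ leavittImage (K := K) hE := by
  cases hS with
  | empty => rw [delta_eq_zero (Set.indicator_empty _)]; exact zero_mem _
  | src x _ => exact skewGen_mem_leavittImage hE (.vertex x)
  | pre a =>
    obtain ⟨l, hl, hc⟩ := a
    induction l with
    | nil => exact absurd rfl hl
    | cons f l ih =>
      by_cases hl' : l = []
      · subst hl'
        have h1 := mul_mem (skewGen_mem_leavittImage (K := K) hE (.edge f))
          (skewGen_mem_leavittImage (K := K) hE (.ghost f))
        convert h1 using 1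
        refine Eq.trans ?_ (skewEdge_mul_skewGhost f).symm
        refine AlgPartialAction.delta_congr _ rfl _ _ (Subtype.ext ?_)
        change Set.indicator _ _ = E.one K _
        rw [one_of]
        congr 1
        ext ξ
        simp [Boundary.HasPrefix]
      · have h1 := mul_mem (skewGen_mem_leavittImage (K := K) hE (.edge f))
          (mul_mem (ih hl' hc.tail (E.indicator_mem_DsX K (.pre _)))
            (skewGen_mem_leavittImage (K := K) hE (.ghost f)))
        convert h1 using 1
        refine (skewEdge_mul_mul_skewGhost f _ _ ?_).symm
        refine (push_indicator f _).trans ?_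
        congr 1
        ext ξ
        constructor
        · rintro ⟨h0, hs⟩ (_ | i) hi
          · simpa using h0
          · rw [← Boundary.edge_shift, hs i (by simpa using hi)]; simp
        · intro hp
          refine ⟨by simpa using hp 0 (by simp), fun i hi => ?_⟩
          rw [Boundary.edge_shift, hp (i + 1) (by simpa using hi)]; simp

theorem delta_one_mem_leavittImage (d : (E.betaAction K).D 1) :
    (E.betaAction K).delta 1 d ∈ leavittImage (K := K) hE := by
  obtain ⟨⟨φ, hφ⟩, hd⟩ := d
  refine DsX_induction (E := E) (K := K) (p := fun φ => ∀ (h : φ ∈ E.DsX K),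
    (E.betaAction K).delta 1 ⟨⟨φ, h⟩, mem_D_one _⟩ ∈ leavittImage (K := K) hE)
    (fun S hS h => delta_one_indicator_mem_leavittImage hE S hS h) ?_ ?_ ?_ hφ hφ
  · intro h
    rw [delta_eq_zero rfl]
    exact zero_mem _
  · intro φ ψ hφ hψ h1 h2 h
    have := add_mem (h1 hφ) (h2 hψ)
    rwa [← map_add] at this
  · intro k φ hφ h1 h
    have := SMulMemClass.smul_mem k (h1 hφ)
    rwa [← map_smul] at this

-- Semi-saturation enters here: along the reduced word of `g`, a coefficient `y` is obtained by
-- applying the first letter to some `z` in the ideal of the remaining word. So `y δ_g` is the image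
-- of an edge or ghost edge times the element with coefficient `z`.
open Classical in
theorem delta_mem_leavittImage (g : FreeGroup A) (d : (E.betaAction K).D g) :
    (E.betaAction K).delta g d ∈ leavittImage (K := K) hE := by
  obtain ⟨l, hl⟩ : ∃ l, g.toWord = l := ⟨_, rfl⟩
  induction l generalizing g with
  | nil =>
    obtain rfl := FreeGroup.toWord_eq_nil_iff.1 hl
    exact delta_one_mem_leavittImage hE d
  | cons a l ih =>
    obtain ⟨y, x, hx⟩ := d
    have hx' : y ∈ AlgPartialAction.wordSymm (E.edgeSymm K) g.toWord x := hx
    rw [hl] at hx'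
    obtain ⟨z, hz, hzy⟩ := (PEquiv.mem_trans _ _ _ _).1 hx'
    -- The tail of a reduced word is reduced, so the partial symmetry of its group element is the
    -- composition along `l`.
    have hl' : (FreeGroup.mk l).toWord = l := by
      have h1 : FreeGroup.IsReduced (a :: l) := hl ▸ FreeGroup.isReduced_toWord
      have h2 : FreeGroup.IsReduced l := List.IsChain.tail h1
      rw [FreeGroup.toWord_mk, h2.reduce_eq]
    have hzD : z ∈ (E.betaAction K).D (FreeGroup.mk l) := by
      refine ⟨x, ?_⟩
      change z ∈ AlgPartialAction.wordSymm (E.edgeSymm K) (FreeGroup.mk l).toWord x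
      rwa [hl']
    have hg : FreeGroup.mk [a] * FreeGroup.mk l = g := by
      rw [FreeGroup.mul_mk, List.singleton_append, ← hl, FreeGroup.mk_toWord]
    have hzmem := ih _ ⟨z, hzD⟩ hl'
    obtain ⟨f, b⟩ := a
    cases b with
    | true =>
      rw [← skewEdge_mul_delta f _ g ⟨z, hzD⟩ _ hg ((mem_edgeSymm f z y).1 hzy).2]
      exact mul_mem (skewGen_mem_leavittImage hE (.edge f)) hzmem
    | false =>
      rw [← skewGhost_mul_delta f _ g ⟨z, hzD⟩ _ hg ((mem_edgeSymm_symm f z y).1 hzy).2]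
      exact mul_mem (skewGen_mem_leavittImage hE (.ghost f)) hzmem

theorem mem_leavittImage_of_skew (s : (E.betaAction K).SkewGroupRing) :
    s ∈ leavittImage (K := K) hE := by
  induction s using AlgPartialAction.SkewGroupRing.induction with
  | zero => exact zero_mem _
  | add x y hx hy => exact add_mem hx hy
  | delta g d => exact delta_mem_leavittImage hE g d

variable (E) in
/-- The homomorphism from the Leavitt path algebra to the partial skew group ring. -/
noncomputable def leavittHom (K : Type w) [Field K] :
    E.leavittPathAlgebra K →ₙ+* (E.betaAction K).SkewGroupRing where
  toFun x := (unitalHom K hE x).toProd.2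
  map_zero' := by
    change (unitalHom K hE 0).toProd.2 = 0
    rw [map_zero, Unitization.snd_zero]
  map_add' x y := by
    change (unitalHom K hE (x + y)).toProd.2 = _
    rw [map_add, Unitization.snd_add]
  map_mul' x y := by
    change (unitalHom K hE (x * y)).toProd.2 = _
    -- The second projection of a unitization is multiplicative only where the scalar parts do not
    -- interfere; here both are zero.
    rw [map_mul, unitalHom_eq_inr hE x.2, unitalHom_eq_inr hE y.2, ← Unitization.inr_mul]
    rfl

theorem leavittHom_bijective : Function.Bijective (E.leavittHom hE K) := by
  constructor
  · refine (injective_iff_map_eq_zero _).2 fun x hx => Subtype.ext ?_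
    refine unitalHom_injective hE x.2 ?_
    rw [unitalHom_eq_inr hE x.2]
    exact congrArg Unitization.inr hx
  · intro s
    obtain ⟨y, hy, hs⟩ := (mem_leavittImage hE s).1 (mem_leavittImage_of_skew hE s)
    exact ⟨⟨y, hy⟩, congrArg (fun z => z.toProd.2) hs⟩

end Hom

end DirGraph

theorem theorem4p3 {V : Type u} {A : Type v} (E : DirGraph V A) (K : Type w) [Field K]
    (hE : ∀ x : V, ¬ E.IsIsolated x) :
    ∃ φ : E.leavittPathAlgebra K ≃+* (E.betaAction K).SkewGroupRing,
      ∀ (k : K) (x : E.leavittPathAlgebra K), φ (k • x) = k • φ x := by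
  refine ⟨RingEquiv.ofBijective (E.leavittHom hE K) (DirGraph.leavittHom_bijective hE),
    fun k x => ?_⟩
  change (DirGraph.unitalHom K hE (k • (x : RingQuot (E.LeavittRel K)))).toProd.2 = _
  rw [map_smul]
  rfl
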